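/- A simplicial complex $X$ (of arbitrary, possibly infinite, dimension) is \emph{flag} if every nonempty finite set of pairwise adjacent vertices spans a simplex. It is \emph{$18$-large} if it is flag and every cycle in its $1$-skeleton of length at least $4$ and smaller than $18$ has a diagonal, that is, there is an edge of $X$ joining two non-consecutive vertices of the cycle. It is \emph{$18$-systolic} if it is $18$-large and simply connected (in particular nonempty and connected). A possibly infinite simplex of $X$ is a nonempty, finite or infinite, set of vertices all of whose nonempty finite subsets span simplices of $X$. A group $G$ acting on $X$ by simplicial automorphisms acts \emph{strongly rigidly} if the only $g\in G$ that stabilizes (as a set) a possibly infinite simplex of dimension at least $1$ (that is, with at least two vertices) is the identity. The action is \emph{locally elliptic} if for every $g\in G$ the cyclic subgroup $\langle g\rangle$ has an orbit of vertices that is bounded in the path metric of the $1$-skeleton, and \emph{elliptic} if $G$ has such a bounded orbit. \textbf{Theorem.} Let $G$ be a finitely generated group acting strongly rigidly, by locally elliptic automorphisms, on an $18$-systolic complex $X$, which is not assumed to be finite-dimensional. Then $G$ acts elliptically on $X$. -/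

import Mathlib

/-!
Systolic simplicial complexes, and groups acting on them. Complexes are Mathlib's
`AbstractSimplicialComplex V`: every point of `V` is a vertex, simplices are nonempty finite
sets of vertices, and no bound on the dimension or on the valence is imposed.
-/

namespace Systolic

universe u v

/-- The 1-skeleton: two distinct vertices are adjacent iff they lie in a common simplex
(equivalently, as simplices are closed under passing to faces, iff they span an edge). -/
def skeleton {V : Type v} (X : AbstractSimplicialComplex V) : SimpleGraph V where
  Adj a b := a ≠ b ∧ ∃ s ∈ X.faces, a ∈ s ∧ b ∈ s
  symm := ⟨fun _ _ h => ⟨h.1.symm, h.2.imp fun _ hs => ⟨hs.1, hs.2.2, hs.2.1⟩⟩⟩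
  loopless := ⟨fun _ h => h.1 rfl⟩

/-- A complex is flag if every nonempty finite set of pairwise adjacent vertices is a simplex. -/
def IsFlag {V : Type v} (X : AbstractSimplicialComplex V) : Prop :=
  ∀ s : Finset V, s.Nonempty → (skeleton X).IsClique (s : Set V) → s ∈ X.faces

/-- A diagonal of a cycle: an edge of the graph joining two vertices of the cycle that are not
consecutive on it, i.e. an edge between vertices of the cycle which is not an edge of the cycle. -/
def HasDiagonal {V : Type v} {Γ : SimpleGraph V} {a : V} (c : Γ.Walk a a) : Prop :=
  ∃ x ∈ c.support, ∃ y ∈ c.support, Γ.Adj x y ∧ s(x, y) ∉ c.edges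

/-- `k`-largeness (used for `6 ≤ k`): the complex is flag, and every cycle of length smaller
than `k` in the 1-skeleton has a diagonal. As usual triangles, which have no pairs of
non-consecutive vertices, are not counted. -/
def IsLarge {V : Type v} (k : ℕ) (X : AbstractSimplicialComplex V) : Prop :=
  IsFlag X ∧ ∀ (a : V) (c : (skeleton X).Walk a a),
    c.IsCycle → 4 ≤ c.length → c.length < k → HasDiagonal c

/-- Homotopy of edge paths relative to the endpoints: the equivalence relation generated by
deleting a backtrack `a b a` and by replacing two sides `a b c` of a 2-simplex by the third
side `a c`. -/
inductive EdgeHomotopic {V : Type v} (X : AbstractSimplicialComplex V) :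
    {x y : V} → (skeleton X).Walk x y → (skeleton X).Walk x y → Prop
  | refl {x y : V} (p : (skeleton X).Walk x y) : EdgeHomotopic X p p
  | symm {x y : V} {p q : (skeleton X).Walk x y} :
      EdgeHomotopic X p q → EdgeHomotopic X q p
  | trans {x y : V} {p q r : (skeleton X).Walk x y} :
      EdgeHomotopic X p q → EdgeHomotopic X q r → EdgeHomotopic X p r
  | backtrack {x y a b : V} (p : (skeleton X).Walk x a) (hab : (skeleton X).Adj a b)
      (q : (skeleton X).Walk a y) :
      EdgeHomotopic X
        (p.append (SimpleGraph.Walk.cons hab (SimpleGraph.Walk.cons hab.symm q)))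
        (p.append q)
  | triangle {x y a b c : V} (p : (skeleton X).Walk x a) (hab : (skeleton X).Adj a b)
      (hbc : (skeleton X).Adj b c) (hac : (skeleton X).Adj a c)
      (habc : ∃ s ∈ X.faces, a ∈ s ∧ b ∈ s ∧ c ∈ s) (q : (skeleton X).Walk c y) :
      EdgeHomotopic X
        (p.append (SimpleGraph.Walk.cons hab (SimpleGraph.Walk.cons hbc q)))
        (p.append (SimpleGraph.Walk.cons hac q))

/-- Simple connectedness of a simplicial complex: it is nonempty and connected, and every
closed edge path is null-homotopic (its edge-path group is trivial). -/
def IsSimplyConnected {V : Type v} (X : AbstractSimplicialComplex V) : Prop :=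
  (skeleton X).Connected ∧
    ∀ (a : V) (p : (skeleton X).Walk a a), EdgeHomotopic X p SimpleGraph.Walk.nil

/-- A `k`-systolic complex: simply connected and `k`-large. -/
def IsSystolic {V : Type v} (k : ℕ) (X : AbstractSimplicialComplex V) : Prop :=
  IsSimplyConnected X ∧ IsLarge k X

/-- The action of `G` on the vertices is an action on `X` by simplicial automorphisms. -/
def ActsByAutomorphisms (G : Type u) [Group G] {V : Type v} [MulAction G V]
    (X : AbstractSimplicialComplex V) : Prop :=
  ∀ (g : G), ∀ s ∈ X.faces, s.map (MulAction.toPerm g).toEmbedding ∈ X.faces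

/-- A (possibly infinite) simplex: a nonempty, finite or infinite, set of vertices all of whose
nonempty finite subsets are simplices of `X`. -/
def IsGeneralizedSimplex {V : Type v} (X : AbstractSimplicialComplex V) (σ : Set V) : Prop :=
  σ.Nonempty ∧ ∀ s : Finset V, s.Nonempty → (s : Set V) ⊆ σ → s ∈ X.faces

/-- A strongly rigid action: only the identity stabilizes (as a set) a possibly infinite
simplex of dimension at least one, i.e. one with at least two vertices. -/
def ActsStronglyRigidly (G : Type u) [Group G] {V : Type v} [MulAction G V]
    (X : AbstractSimplicialComplex V) : Prop :=
  ∀ (g : G) (σ : Set V), IsGeneralizedSimplex X σ → σ.Nontrivial →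
    (fun x => g • x) '' σ = σ → g = 1

/-- A set of vertices is bounded if it has finite diameter in the path metric of the
1-skeleton. -/
def IsBoundedSet {V : Type v} (X : AbstractSimplicialComplex V) (S : Set V) : Prop :=
  ∃ n : ℕ, ∀ x ∈ S, ∀ y ∈ S, (skeleton X).edist x y ≤ (n : ℕ∞)

/-- An elliptic action: the group has a bounded orbit. -/
def ActsElliptically (G : Type u) [Group G] {V : Type v} [MulAction G V]
    (X : AbstractSimplicialComplex V) : Prop :=
  ∃ x : V, IsBoundedSet X (MulAction.orbit G x)

/-- A locally elliptic action: each element (i.e. each cyclic subgroup) has a bounded orbit. -/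
def ActsLocallyElliptically (G : Type u) [Group G] {V : Type v} [MulAction G V]
    (X : AbstractSimplicialComplex V) : Prop :=
  ∀ g : G, ActsElliptically (Subgroup.zpowers g) X

end Systolic

/-! The argument is ping-pong with coarse centres, driven by exponential contraction towards convex
sets.

Simple connectedness is used only through two distance conditions: adjacent vertices at equal
distance from a base vertex have a common neighbour closer to it, and the neighbours of a vertex
that are closer form a clique. They hold by construction in a complex developed from the base vertex
level by level, where the absence of diagonals in short cycles keeps each level consistent. The
development maps to the given complex isomorphically on closed stars, so it is a connected covering
of a simply connected complex, hence injective, and levels are distances.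

The distance conditions make connected, locally convex sets convex (`isConvex_of_local`), so
neighbourhoods of convex sets are convex. Let K be convex. Moving one level towards K halves a path
of constant distance to K (`flat_lower`). Consequently shadows on K of nearby distant vertices are
adjacent or equal (`near_shadow_of_walk`), and a geodesic avoiding a neighbourhood of K has a shadow
of diameter bounded by a universal constant (`dist_shadow_le`).

A nontrivial element g with bounded orbits has an invariant convex centre K of diameter at most 11
(`exists_isCenter`). If the orbit of some vertex p at distance 40 from K were small, its shadows
next to K would form an invariant clique, possibly infinite, and strong rigidity would give g = 1
(`eq_one_of_orbit`). So some power of g moves p far. If the centres A and B of nontrivial a and b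
were 200 apart, suitable powers would play ping-pong: a product `b ^ i * a ^ j` would push a vertex
further and further away from A, contradicting local ellipticity (`exists_dist_lt_of_isCenter`).
Hence the centre of one nontrivial a is close to all of its translates, which are centres of the
conjugates of a, and the orbit of a vertex of this centre is bounded. -/

namespace Systolic

/-- Two vertices are near if they are equal or adjacent. -/
def Near {V : Type*} (Γ : SimpleGraph V) (x y : V) : Prop := x = y ∨ Γ.Adj x y

/-- Every cycle of length at least `4` and smaller than `18` has a diagonal. -/
def ShortCyclesHaveDiagonals {V : Type*} (Γ : SimpleGraph V) : Prop :=
  ∀ (a : V) (c : Γ.Walk a a), c.IsCycle → 4 ≤ c.length → c.length < 18 → HasDiagonal c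

/-! ### Short cycles and their diagonals -/

section Graph

variable {V : Type*} {Γ : SimpleGraph V}

theorem Near.refl (x : V) : Near Γ x x := Or.inl rfl

theorem Near.symm {x y : V} (h : Near Γ x y) : Near Γ y x :=
  h.imp Eq.symm SimpleGraph.Adj.symm

theorem Near.of_adj {x y : V} (h : Γ.Adj x y) : Near Γ x y := Or.inr h

theorem exists_shorter_walk {a b : V} (w : Γ.Walk a b) {i j : ℕ} (hij : i < j)
    (hj : j ≤ w.length) (hadj : Γ.Adj (w.getVert i) (w.getVert j))
    (he : s(w.getVert i, w.getVert j) ∉ w.edges) :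
    ∃ w' : Γ.Walk a b, w'.length < w.length ∧ w'.support ⊆ w.support := by
  have hj' : j ≠ i + 1 := by
    rintro rfl
    apply he
    have := w.toSubgraph_adj_getVert (i := i) (by omega)
    rwa [← SimpleGraph.Subgraph.mem_edgeSet, SimpleGraph.Walk.mem_edges_toSubgraph] at this
  refine ⟨(w.take i).append (SimpleGraph.Walk.cons hadj (w.drop j)), ?_, ?_⟩
  · simp only [SimpleGraph.Walk.length_append, SimpleGraph.Walk.length_cons,
      SimpleGraph.Walk.take_length, SimpleGraph.Walk.drop_length]
    omega
  · intro x hx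
    rw [SimpleGraph.Walk.mem_support_append_iff, SimpleGraph.Walk.support_cons,
      List.mem_cons] at hx
    rcases hx with hx | rfl | hx
    · exact (w.isSubwalk_take i).support_subset hx
    · exact w.getVert_mem_support i
    · exact (w.isSubwalk_drop j).support_subset hx

/-- A shortest walk from a to b within the support of w is a path without chords. Closing it up
through m gives a cycle with at most 17 edges, and its diagonal can only issue from m. -/
theorem exists_adj_of_walk (hΓ : ShortCyclesHaveDiagonals Γ) {a b m : V} (ha : Γ.Adj m a)
    (hb : Γ.Adj m b) (hab : ¬ Near Γ a b) (w : Γ.Walk a b) (hm : m ∉ w.support)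
    (hl : w.length ≤ 15) : ∃ c ∈ w.support, c ≠ a ∧ c ≠ b ∧ Γ.Adj m c := by
  obtain ⟨hne, hna⟩ := not_or.1 hab
  induction h : w.length using Nat.strong_induction_on generalizing w with
  | _ n ih =>
    subst h
    by_cases hs : ∃ w' : Γ.Walk a b, w'.length < w.length ∧ w'.support ⊆ w.support
    · obtain ⟨w', hlt, hsub⟩ := hs
      obtain ⟨c, hc, h⟩ := ih _ hlt w' (fun h => hm (hsub h)) (by omega) rfl
      exact ⟨c, hsub hc, h⟩
    · have hchord : ∀ x ∈ w.support, ∀ y ∈ w.support, Γ.Adj x y → s(x, y) ∈ w.edges := by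
        intro x hx y hy hxy
        by_contra he
        obtain ⟨i, rfl, hi⟩ := SimpleGraph.Walk.mem_support_iff_exists_getVert.1 hx
        obtain ⟨j, rfl, hj⟩ := SimpleGraph.Walk.mem_support_iff_exists_getVert.1 hy
        rcases lt_trichotomy i j with hij | rfl | hij
        · exact hs (exists_shorter_walk w hij hj hxy he)
        · exact hxy.ne rfl
        · exact hs (exists_shorter_walk w hij hi hxy.symm (by rwa [Sym2.eq_swap]))
      have hpath : w.IsPath := by
        classical
        by_contra hp
        refine hs ⟨w.bypass, ?_, w.support_bypass_subset_support⟩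
        refine lt_of_le_of_ne w.length_bypass_le_length fun h => hp ?_
        have := w.bypass_eq_self_of_length_le_length_bypass h.ge
        rw [← this]
        exact w.bypass_isPath
      have hlen : 2 ≤ w.length := by
        by_contra! hlt
        interval_cases h : w.length
        · exact hne (SimpleGraph.Walk.eq_of_length_eq_zero h)
        · exact hna (SimpleGraph.Walk.adj_of_length_eq_one h)
      have hcyc : (SimpleGraph.Walk.cons ha (w.concat hb.symm)).IsCycle := by
        rw [SimpleGraph.Walk.cons_isCycle_iff]
        refine ⟨hpath.concat hm hb.symm, ?_⟩
        rw [SimpleGraph.Walk.edges_concat, List.concat_eq_append, List.mem_append]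
        rintro (h | h)
        · exact hm (w.fst_mem_support_of_mem_edges h)
        · rw [List.mem_singleton, Sym2.eq_iff] at h
          rcases h with ⟨rfl, _⟩ | ⟨_, h⟩
          · exact hb.ne rfl
          · exact hne h
      obtain ⟨x, hx, y, hy, hxy, he⟩ := hΓ m _ hcyc (by simp; omega) (by simp; omega)
      have key : ∀ y ∈ w.support, Γ.Adj m y →
          s(m, y) ∉ (SimpleGraph.Walk.cons ha (w.concat hb.symm)).edges →
          ∃ c ∈ w.support, c ≠ a ∧ c ≠ b ∧ Γ.Adj m c := by
        intro y hy hmy he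
        refine ⟨y, hy, ?_, ?_, hmy⟩
        · rintro rfl
          exact he (by simp)
        · rintro rfl
          exact he (by simp [SimpleGraph.Walk.edges_concat])
      have hsupp : ∀ z ∈ (SimpleGraph.Walk.cons ha (w.concat hb.symm)).support,
          z = m ∨ z ∈ w.support := by
        intro z hz
        simp [SimpleGraph.Walk.support_concat] at hz
        tauto
      rcases hsupp x hx with rfl | hxw
      · rcases hsupp y hy with rfl | hyw
        · exact absurd rfl hxy.ne
        · exact key y hyw hxy he
      · rcases hsupp y hy with rfl | hyw
        · exact key x hxw hxy.symm (by rwa [Sym2.eq_swap])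
        · exact absurd (by simp [SimpleGraph.Walk.edges_concat, hchord x hxw y hyw hxy]) he

theorem exists_walk_of_isChain (l : List V) (a b : V) (h : List.IsChain (Near Γ) (a :: (l ++ [b]))) :
    ∃ w : Γ.Walk a b, w.length ≤ l.length + 1 ∧ w.support ⊆ a :: (l ++ [b]) := by
  induction l generalizing a with
  | nil =>
    rcases (by simpa using h : Near Γ a b) with rfl | h
    · exact ⟨SimpleGraph.Walk.nil, by simp, by simp⟩
    · exact ⟨SimpleGraph.Walk.cons h SimpleGraph.Walk.nil, by simp, by simp⟩
  | cons c l ih =>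
    rw [List.cons_append, List.isChain_cons_cons] at h
    obtain ⟨w, hw, hs⟩ := ih c h.2
    rcases h.1 with rfl | h
    · exact ⟨w, by simp; omega, fun x hx => List.mem_cons_of_mem _ (hs hx)⟩
    · refine ⟨SimpleGraph.Walk.cons h w, by simp; omega, fun x hx => ?_⟩
      rw [SimpleGraph.Walk.support_cons, List.mem_cons] at hx
      exact List.mem_cons.2 (hx.imp_right fun hx => hs hx)

/-- In a short closed chain, a vertex which is not near any vertex other than its two neighbours
is the tip of an ear. -/
theorem near_of_chain (hΓ : ShortCyclesHaveDiagonals Γ) {a b m : V} (l : List V)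
    (ha : Near Γ m a) (hb : Near Γ m b) (h : List.IsChain (Near Γ) (a :: (l ++ [b])))
    (hl : l.length ≤ 14) (hm : ∀ c ∈ l, ¬ Near Γ m c) : Near Γ a b := by
  rcases ha with rfl | ha
  · exact hb
  rcases hb with rfl | hb
  · exact Or.inr ha.symm
  by_contra hab
  obtain ⟨w, hw, hs⟩ := exists_walk_of_isChain l a b h
  obtain ⟨c, hc, hca, hcb, hmc⟩ := exists_adj_of_walk hΓ ha hb hab w (fun hmw => by
    have := hs hmw
    simp only [List.mem_cons, List.mem_append, List.not_mem_nil, or_false] at this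
    rcases this with rfl | h | rfl
    · exact ha.ne rfl
    · exact hm m h (Near.refl m)
    · exact hb.ne rfl) (by omega)
  have := hs hc
  simp only [List.mem_cons, List.mem_append, List.not_mem_nil, or_false] at this
  rcases this with rfl | h | rfl
  · exact hca rfl
  · exact hm c h (Or.inr hmc)
  · exact hcb rfl

end Graph

/-! ### Star coverings and lifting of homotopies -/

section Covering

variable {V : Type*} {X : AbstractSimplicialComplex V} {E : Type*}

/-- `Lifts f N p e e'`: the walk `p` lifts along `f` to an `N`-walk from `e` to `e'`. -/
def Lifts (f : E → V) (N : E → E → Prop) {Γ : SimpleGraph V} :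
    {x y : V} → Γ.Walk x y → E → E → Prop
  | x, _, SimpleGraph.Walk.nil, e, e' => e = e' ∧ f e = x
  | x, _, SimpleGraph.Walk.cons _ p, e, e' => f e = x ∧ ∃ e₁, N e e₁ ∧ Lifts f N p e₁ e'

variable {f : E → V} {N : E → E → Prop} {Γ : SimpleGraph V}

theorem Lifts.source {x y : V} {p : Γ.Walk x y} {e e' : E} (h : Lifts f N p e e') : f e = x := by
  cases p with
  | nil => exact h.2
  | cons _ _ => exact h.1

theorem Lifts.target {x y : V} {p : Γ.Walk x y} {e e' : E} (h : Lifts f N p e e') : f e' = y := by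
  induction p generalizing e with
  | nil => exact h.1 ▸ h.2
  | cons _ _ ih =>
    obtain ⟨_, _, _, h⟩ := h
    exact ih h

theorem lifts_append {x y z : V} {p : Γ.Walk x y} {q : Γ.Walk y z} {e e'' : E} :
    Lifts f N (p.append q) e e'' ↔ ∃ e', Lifts f N p e e' ∧ Lifts f N q e' e'' := by
  induction p generalizing e with
  | nil =>
    constructor
    · intro h
      exact ⟨e, ⟨rfl, h.source⟩, h⟩
    · rintro ⟨_, ⟨rfl, _⟩, h⟩
      exact h
  | cons _ p ih =>
    constructor
    · rintro ⟨hx, e₁, h₁, h⟩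
      obtain ⟨e', hp, hq⟩ := ih.1 h
      exact ⟨e', ⟨hx, e₁, h₁, hp⟩, hq⟩
    · rintro ⟨e', ⟨hx, e₁, h₁, hp⟩, hq⟩
      exact ⟨hx, e₁, h₁, ih.2 ⟨e', hp, hq⟩⟩

/-- A map of graphs which is an isomorphism on closed stars. -/
structure IsStarCovering (Γ : SimpleGraph V) (f : E → V) (N : E → E → Prop) : Prop where
  symm : ∀ {e e'}, N e e' → N e' e
  adj : ∀ {e e'}, N e e' → Γ.Adj (f e) (f e')
  star : ∀ {e a b}, N e a → N e b → Near Γ (f a) (f b) → a = b ∨ N a b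
  surj : ∀ {e z}, Γ.Adj (f e) z → ∃ e', N e e' ∧ f e' = z

namespace IsStarCovering

variable (h : IsStarCovering Γ f N)
include h

theorem injOn {e a b : E} (ha : N e a) (hb : N e b) (hab : f a = f b) : a = b :=
  (h.star ha hb (Or.inl hab)).resolve_right fun hN => (h.adj hN).ne hab

theorem lifts_unique {x y : V} {p : Γ.Walk x y} {e e₁ e₂ : E} (h₁ : Lifts f N p e e₁)
    (h₂ : Lifts f N p e e₂) : e₁ = e₂ := by
  induction p generalizing e with
  | nil => exact h₁.1.symm.trans h₂.1
  | cons _ p ih =>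
    obtain ⟨_, a, ha, h₁⟩ := h₁
    obtain ⟨_, b, hb, h₂⟩ := h₂
    obtain rfl := h.injOn ha hb (h₁.source.trans h₂.source.symm)
    exact ih h₁ h₂

theorem exists_lifts {x y : V} (p : Γ.Walk x y) (e : E) (he : f e = x) :
    ∃ e', Lifts f N p e e' := by
  induction p generalizing e with
  | nil => exact ⟨e, rfl, he⟩
  | cons hadj p ih =>
    subst he
    obtain ⟨a, ha, hfa⟩ := h.surj hadj
    obtain ⟨e', he'⟩ := ih a hfa
    exact ⟨e', rfl, a, ha, he'⟩

theorem lifts_reverse {x y : V} {p : Γ.Walk x y} {e e' : E} (hp : Lifts f N p e e') :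
    Lifts f N p.reverse e' e := by
  induction p generalizing e with
  | nil => exact ⟨hp.1.symm, hp.1 ▸ hp.2⟩
  | cons hadj p ih =>
    obtain ⟨hx, a, ha, hp⟩ := hp
    rw [SimpleGraph.Walk.reverse_cons, lifts_append]
    exact ⟨a, ih hp, hp.source, e, h.symm ha, rfl, hx⟩

theorem exists_walk {e e' : E} (hr : Relation.ReflTransGen N e e') :
    ∃ p : Γ.Walk (f e) (f e'), Lifts f N p e e' := by
  induction hr using Relation.ReflTransGen.head_induction_on with
  | refl => exact ⟨SimpleGraph.Walk.nil, rfl, rfl⟩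
  | head hN _ ih =>
    obtain ⟨p, hp⟩ := ih
    exact ⟨SimpleGraph.Walk.cons (h.adj hN) p, rfl, _, hN, hp⟩

end IsStarCovering

/-- A lifted backtrack returns to its start because the map is injective on stars. Triangles lift to
triangles because adjacency inside a star is reflected as well as preserved. -/
theorem IsStarCovering.lifts_iff_of_edgeHomotopic (h : IsStarCovering (skeleton X) f N) {x y : V}
    {p q : (skeleton X).Walk x y} (hpq : EdgeHomotopic X p q) :
    ∀ e e', Lifts f N p e e' ↔ Lifts f N q e e' := by
  induction hpq with
  | refl p => exact fun _ _ => Iff.rfl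
  | symm _ ih => exact fun e e' => (ih e e').symm
  | trans _ _ ih₁ ih₂ => exact fun e e' => (ih₁ e e').trans (ih₂ e e')
  | backtrack p hab q =>
    intro e e'
    simp only [lifts_append]
    refine exists_congr fun e₁ => and_congr_right fun hp => ?_
    constructor
    · rintro ⟨h₁, e₂, h₂, -, e₃, h₃, hq⟩
      obtain rfl := h.injOn (h.symm h₂) h₃ (h₁.trans hq.source.symm)
      exact hq
    · intro hq
      obtain ⟨e₂, h₂, hf⟩ := h.surj (e := e₁) (by rw [hq.source]; exact hab)
      exact ⟨hq.source, e₂, h₂, hf, e₁, h.symm h₂, hq⟩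
  | triangle p hab hbc hac _ q =>
    intro e e'
    simp only [lifts_append]
    refine exists_congr fun e₁ => and_congr_right fun hp => ?_
    constructor
    · rintro ⟨h₁, e₂, h₂, -, e₃, h₃, hq⟩
      refine ⟨h₁, e₃, ?_, hq⟩
      have hadj : (skeleton X).Adj (f e₁) (f e₃) := by rw [h₁, hq.source]; exact hac
      refine (h.star (h.symm h₂) h₃ (Or.inr hadj)).resolve_left ?_
      rintro rfl
      exact hadj.ne rfl
    · rintro ⟨h₁, e₃, h₃, hq⟩
      obtain ⟨e₂, h₂, hf⟩ := h.surj (e := e₁) (by rw [h₁]; exact hab)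
      have hadj : (skeleton X).Adj (f e₂) (f e₃) := by rw [hf, hq.source]; exact hbc
      refine ⟨h₁, e₂, h₂, hf, e₃, ?_, hq⟩
      refine (h.star h₂ h₃ (Or.inr hadj)).resolve_left ?_
      rintro rfl
      exact hadj.ne rfl

/-- A connected covering of a simply connected complex is injective. -/
theorem IsStarCovering.injective (h : IsStarCovering (skeleton X) f N)
    (hX : ∀ (a : V) (p : (skeleton X).Walk a a), EdgeHomotopic X p SimpleGraph.Walk.nil)
    (e₀ : E) (hreach : ∀ e, Relation.ReflTransGen N e₀ e) : Function.Injective f := by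
  intro e e' hee
  obtain ⟨p, hp⟩ := h.exists_walk (hreach e)
  obtain ⟨q, hq⟩ := h.exists_walk (hreach e')
  obtain ⟨p', hp'⟩ : ∃ p' : (skeleton X).Walk (f e₀) (f e'), Lifts f N p' e₀ e := by
    rw [← hee]
    exact ⟨p, hp⟩
  have hnil : Lifts f N (p'.append q.reverse) e₀ e₀ :=
    (h.lifts_iff_of_edgeHomotopic (hX _ _) _ _).2 ⟨rfl, rfl⟩
  obtain ⟨e₁, h₁, h₂⟩ := lifts_append.1 hnil
  obtain rfl := h.lifts_unique h₁ hp'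
  have := h.lifts_reverse h₂
  rw [SimpleGraph.Walk.reverse_reverse] at this
  exact h.lifts_unique this hq

end Covering

/-! ### The development, level by level -/

section Levels

variable {V : Type*} (Γ : SimpleGraph V) (u : V)

/-- A level of the tree-like development: its vertices (lists ending in their image), its edges,
and the edges which join it to the previous level. -/
structure Level (V : Type*) where
  S : Set (List V)
  A : List V → List V → Prop
  L : List V → List V → Prop

/-- The vertex of the complex represented by a list. -/
def headV (x : List V) : V := x.headD u

/-- The vertex `z` is adjacent to the image of `y`, but not near the image of the lower star of
`y`. -/
def Adm (D : Level V) (y : List V) (z : V) : Prop :=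
  y ∈ D.S ∧ Γ.Adj (headV u y) z ∧ ∀ w, D.L y w → ¬ Near Γ z (headV u w)

/-- The vertices of the next level; of all equivalent ones the representative that is smallest in
a well-order is chosen. -/
def NextS (D : Level V) : Set (List V) :=
  {x | ∃ z y, x = z :: y ∧ Adm Γ u D y z ∧
    ∀ y', D.A y y' → Adm Γ u D y' z → ¬ WellOrderingRel y' y}

/-- The edges between a level and the next one. -/
def NextL (D : Level V) (x y : List V) : Prop :=
  x ∈ NextS Γ u D ∧ ∃ z y₀, x = z :: y₀ ∧ Adm Γ u D y z ∧ (y₀ = y ∨ D.A y₀ y)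

/-- The next level of the development. -/
def nextLevel (D : Level V) : Level V where
  S := NextS Γ u D
  A x x' := Γ.Adj (headV u x) (headV u x') ∧ ∃ y, NextL Γ u D x y ∧ NextL Γ u D x' y
  L := NextL Γ u D

/-- The levels of the development based at `u`. -/
def level : ℕ → Level V
  | 0 => ⟨{[u]}, fun _ _ => False, fun _ _ => False⟩
  | n + 1 => nextLevel Γ u (level n)

/-- The properties which are kept up by the construction of the levels. -/
structure LevelInv (P D : Level V) : Prop where
  A_mem : ∀ {x x'}, D.A x x' → x ∈ D.S
  A_symm : ∀ {x x'}, D.A x x' → D.A x' x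
  A_adj : ∀ {x x'}, D.A x x' → Γ.Adj (headV u x) (headV u x')
  L_mem' : ∀ {x y}, D.L x y → y ∈ P.S
  L_adj : ∀ {x y}, D.L x y → Γ.Adj (headV u x) (headV u y)
  L_L : ∀ {x y y'}, D.L x y → D.L x y' → y = y' ∨ P.A y y'
  P_adj : ∀ {x x'}, P.A x x' → Γ.Adj (headV u x) (headV u x')
  exists_lower : ∀ {x x'}, D.A x x' → ∃ y, D.L x y ∧ D.L x' y
  A_L : ∀ {x a y}, D.A x a → D.L x y → Near Γ (headV u a) (headV u y) → D.L a y
  A_A : ∀ {x a b}, D.A x a → D.A x b → Near Γ (headV u a) (headV u b) → a = b ∨ D.A a b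

variable {Γ u} {P D : Level V}

namespace LevelInv

variable (I : LevelInv Γ u P D)
include I

theorem near_of_L_L {x y y' : List V} (h : D.L x y) (h' : D.L x y') :
    Near Γ (headV u y) (headV u y') :=
  (I.L_L h h').imp (congrArg _) I.P_adj

/-- This is transitivity of the relation identifying the pairs (z, y) that should give the same new
vertex. Lower neighbours w, w' shared by y₀ with y and y' close up a chain z, y, w, w', y'. As z is
near neither w nor w', the images of y and y' are near, and this lifts inside the star of y₀. -/
theorem eq_or_A_of_adm (hΓ : ShortCyclesHaveDiagonals Γ) {y₀ y y' : List V} {z : V}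
    (h₀ : Adm Γ u D y₀ z) (h : Adm Γ u D y z) (h' : Adm Γ u D y' z) (hy : D.A y₀ y)
    (hy' : D.A y₀ y') : y = y' ∨ D.A y y' := by
  obtain ⟨w, hw₀, hw⟩ := I.exists_lower hy
  obtain ⟨w', hw₀', hw'⟩ := I.exists_lower hy'
  refine I.A_A hy hy' (near_of_chain hΓ (m := z) [headV u w, headV u w'] (Or.inr h.2.1.symm)
    (Or.inr h'.2.1.symm) ?_ (by simp) ?_)
  · simp [Near.of_adj (I.L_adj hw), Near.of_adj (I.L_adj hw').symm, I.near_of_L_L hw₀ hw₀']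
  · simpa using ⟨h₀.2.2 w hw₀, h₀.2.2 w' hw₀'⟩

theorem eq_or_A_of_adm' (hΓ : ShortCyclesHaveDiagonals Γ) {y₀ y y' : List V} {z : V}
    (h₀ : Adm Γ u D y₀ z) (h : Adm Γ u D y z) (h' : Adm Γ u D y' z) (hy : y₀ = y ∨ D.A y₀ y)
    (hy' : y₀ = y' ∨ D.A y₀ y') : y = y' ∨ D.A y y' := by
  rcases hy with rfl | hy
  · exact hy'
  rcases hy' with rfl | hy'
  · exact Or.inr (I.A_symm hy)
  exact I.eq_or_A_of_adm hΓ h₀ h h' hy hy'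

omit I in
theorem adm_of_mem {z : V} {y₀ : List V} (h : z :: y₀ ∈ NextS Γ u D) : Adm Γ u D y₀ z := by
  obtain ⟨_, _, h, h', -⟩ := h
  cases h
  exact h'

omit I in
theorem adm_of_nextL {x y : List V} (h : NextL Γ u D x y) : Adm Γ u D y (headV u x) := by
  obtain ⟨_, z, y₀, rfl, h, -⟩ := h
  exact h

omit I in
theorem not_near {x y w : List V} (h : NextL Γ u D x y) (hw : D.L y w) :
    ¬ Near Γ (headV u x) (headV u w) :=
  (adm_of_nextL h).2.2 w hw

/-- Vertices near x in the star of y must also lie below x. The danger is that z is near a lower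
neighbour w' of a; then the chain z, y, w, w', with w below both y and a, makes y near w', so w'
lies below y and the admissibility of y fails. -/
theorem nextL_of_near (hΓ : ShortCyclesHaveDiagonals Γ) {x y a : List V} (hx : NextL Γ u D x y)
    (ha : D.A y a) (hxa : Near Γ (headV u x) (headV u a)) : NextL Γ u D x a := by
  obtain ⟨hxS, z, y₀, rfl, hy, hy₀⟩ := hx
  have h₀ := adm_of_mem hxS
  change Near Γ z _ at hxa
  obtain ⟨w, hyw, haw⟩ := I.exists_lower ha
  have hzw := hy.2.2 w hyw
  have hza : Γ.Adj (headV u a) z := by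
    rcases hxa with h | h
    · exact absurd (Or.inr (h ▸ I.L_adj haw)) hzw
    · exact h.symm
  have hadm : Adm Γ u D a z := by
    refine ⟨I.A_mem (I.A_symm ha), hza, fun w' haw' hzw' => ?_⟩
    have h₁ : ¬ Near Γ (headV u y) (headV u w') := fun h =>
      hy.2.2 w' (I.A_L (I.A_symm ha) haw' h) hzw'
    refine h₁ (near_of_chain hΓ (m := z) [headV u w] (Or.inr hy.2.1.symm) hzw' ?_ (by simp)
      (by simpa using hzw))
    simp [Near.of_adj (I.L_adj hyw), I.near_of_L_L haw haw']
  refine ⟨hxS, z, y₀, rfl, hadm, ?_⟩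
  refine I.eq_or_A_of_adm' hΓ hy h₀ hadm ?_ (Or.inr ha)
  exact hy₀.imp Eq.symm I.A_symm

theorem nextL_nextL (hΓ : ShortCyclesHaveDiagonals Γ) {x y y' : List V} (h : NextL Γ u D x y)
    (h' : NextL Γ u D x y') : y = y' ∨ D.A y y' := by
  obtain ⟨hS, z, y₀, rfl, hy, hy₀⟩ := h
  obtain ⟨_, z', y₀', he, hy', hy₀'⟩ := h'
  cases he
  exact I.eq_or_A_of_adm' hΓ (adm_of_mem hS) hy hy' hy₀ hy₀'

theorem eq_or_A_of_common (hΓ : ShortCyclesHaveDiagonals Γ) {x x' y : List V}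
    (h : NextL Γ u D x y) (h' : NextL Γ u D x' y) (hxx : Near Γ (headV u x) (headV u x')) :
    x = x' ∨ (nextLevel Γ u D).A x x' := by
  rcases hxx with hxx | hxx
  · left
    obtain ⟨hS, z, y₀, rfl, hy, hy₀⟩ := h
    obtain ⟨hS', z', y₀', rfl, -, hy₀'⟩ := h'
    obtain rfl : z = z' := hxx
    have h₀ := adm_of_mem hS
    have h₀' := adm_of_mem hS'
    rcases I.eq_or_A_of_adm' hΓ hy h₀ h₀' (hy₀.imp Eq.symm I.A_symm)
      (hy₀'.imp Eq.symm I.A_symm) with rfl | hA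
    · rfl
    · obtain ⟨_, _, he, -, hmin⟩ := hS
      cases he
      obtain ⟨_, _, he, -, hmin'⟩ := hS'
      cases he
      rcases trichotomous_of WellOrderingRel y₀ y₀' with h | h | h
      · exact absurd h (hmin' _ (I.A_symm hA) h₀)
      · rw [h]
      · exact absurd h (hmin _ hA h₀')
  · exact Or.inr ⟨hxx, y, h, h'⟩

/-- The representative is the least element among y and its neighbours admissible for z. By
transitivity it is also minimal among its own neighbours, as membership in `NextS` demands. -/
theorem exists_nextL (hΓ : ShortCyclesHaveDiagonals Γ) {y : List V} {z : V} (h : Adm Γ u D y z) :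
    ∃ x, NextL Γ u D x y ∧ headV u x = z := by
  obtain ⟨y₀, ⟨h₀, hy₀⟩, hmin⟩ := (IsWellFounded.wf (r := WellOrderingRel (α := List V))).has_min
    {y' | Adm Γ u D y' z ∧ (y = y' ∨ D.A y y')} ⟨y, h, Or.inl rfl⟩
  refine ⟨z :: y₀, ⟨⟨z, y₀, rfl, h₀, fun y' hA hy' => hmin y' ⟨hy', ?_⟩⟩, z, y₀, rfl, h,
    hy₀.imp Eq.symm I.A_symm⟩, rfl⟩
  exact I.eq_or_A_of_adm' hΓ h₀ h hy' (hy₀.imp Eq.symm I.A_symm) (Or.inr hA)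

theorem next (hΓ : ShortCyclesHaveDiagonals Γ) : LevelInv Γ u D (nextLevel Γ u D) where
  A_mem := fun ⟨_, _, h, _⟩ => h.1
  A_symm := fun ⟨h, y, h₁, h₂⟩ => ⟨h.symm, y, h₂, h₁⟩
  A_adj := fun h => h.1
  L_mem' := fun h => (adm_of_nextL h).1
  L_adj := fun h => (adm_of_nextL h).2.1.symm
  L_L := fun h h' => I.nextL_nextL hΓ h h'
  P_adj := fun h => I.A_adj h
  exists_lower := fun h => h.2
  A_L := by
    rintro x a y ⟨-, y₁, hx₁, ha₁⟩ hxy hay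
    rcases I.nextL_nextL hΓ hx₁ hxy with rfl | hA
    · exact ha₁
    · exact I.nextL_of_near hΓ ha₁ hA hay
  A_A := by
    rintro x a b ⟨hxa, y₁, hx₁, ha₁⟩ ⟨hxb, y₂, hx₂, hb₂⟩ hab
    rcases I.nextL_nextL hΓ hx₁ hx₂ with rfl | hA
    · exact I.eq_or_A_of_common hΓ ha₁ hb₂ hab
    by_cases h₁ : Near Γ (headV u y₁) (headV u b)
    · exact I.eq_or_A_of_common hΓ ha₁ (I.nextL_of_near hΓ hb₂ (I.A_symm hA) h₁.symm) hab
    by_cases h₂ : Near Γ (headV u a) (headV u y₂)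
    · exact I.eq_or_A_of_common hΓ (I.nextL_of_near hΓ ha₁ hA h₂) hb₂ hab
    -- The remaining case is a chain a, y₁, y₂, b in which both possible diagonals are excluded.
    refine absurd (near_of_chain hΓ (m := headV u a) [headV u y₂]
      (Or.inr (adm_of_nextL ha₁).2.1.symm) hab ?_ (by simp) (by simpa using h₂)) h₁
    simp [Near.of_adj (I.A_adj hA), Near.of_adj (adm_of_nextL hb₂).2.1]

end LevelInv

end Levels

/-! ### The development is a covering, and its levels are distances -/

section Development

variable {V : Type*} (Γ : SimpleGraph V) (u : V)

theorem levelInv (hΓ : ShortCyclesHaveDiagonals Γ) :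
    ∀ n, LevelInv Γ u (level Γ u n) (level Γ u (n + 1))
  | 0 => by
    -- An empty level is placed below level zero, so that the first step is an instance of the
    -- general one.
    refine LevelInv.next (P := ⟨∅, fun _ _ => False, fun _ _ => False⟩) ?_ hΓ
    constructor <;> intros <;> exact False.elim ‹_›
  | n + 1 => (levelInv hΓ n).next hΓ

/-- The vertices of the development based at `u`. -/
def DevVertex : Type _ := {e : ℕ × List V // e.2 ∈ (level Γ u e.1).S}

/-- The projection of the development. -/
def devMap (e : DevVertex Γ u) : V := headV u e.1.2

/-- Adjacency in the development. -/
inductive DevAdj : DevVertex Γ u → DevVertex Γ u → Prop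
  | same {n : ℕ} {x y : List V} (hx : x ∈ (level Γ u n).S) (hy : y ∈ (level Γ u n).S)
      (h : (level Γ u n).A x y) : DevAdj ⟨(n, x), hx⟩ ⟨(n, y), hy⟩
  | down {n : ℕ} {x y : List V} (hx : x ∈ (level Γ u (n + 1)).S) (hy : y ∈ (level Γ u n).S)
      (h : (level Γ u (n + 1)).L x y) : DevAdj ⟨(n + 1, x), hx⟩ ⟨(n, y), hy⟩
  | up {n : ℕ} {x y : List V} (hx : x ∈ (level Γ u n).S) (hy : y ∈ (level Γ u (n + 1)).S)
      (h : (level Γ u (n + 1)).L y x) : DevAdj ⟨(n, x), hx⟩ ⟨(n + 1, y), hy⟩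

variable {Γ u}

theorem levelInv' (hΓ : ShortCyclesHaveDiagonals Γ) (n : ℕ) :
    ∃ P, LevelInv Γ u P (level Γ u n) := by
  cases n with
  | zero =>
    refine ⟨⟨∅, fun _ _ => False, fun _ _ => False⟩, ?_⟩
    constructor <;> intros <;> exact False.elim ‹_›
  | succ n => exact ⟨_, levelInv Γ u hΓ n⟩

theorem devAdj_star (hΓ : ShortCyclesHaveDiagonals Γ) {e a b : DevVertex Γ u}
    (ha : DevAdj Γ u e a) (hb : DevAdj Γ u e b) (hab : Near Γ (devMap Γ u a) (devMap Γ u b)) :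
    a = b ∨ DevAdj Γ u a b := by
  cases ha with
  | same hx hy h =>
    rename_i n x y
    obtain ⟨P, I⟩ := levelInv' (u := u) hΓ n
    cases hb with
    | same _ hz h' =>
      rcases I.A_A h h' hab with rfl | hA
      · exact Or.inl rfl
      · exact Or.inr (.same _ _ hA)
    | down _ hz h' => exact Or.inr (.down _ _ ((levelInv Γ u hΓ _).A_L h h' hab))
    | up _ hz h' => exact Or.inr (.up _ _ (I.nextL_of_near hΓ h' h hab.symm))
  | down hx hy h =>
    rename_i n x y
    have I := levelInv Γ u hΓ n
    cases hb with
    | same _ hz h' => exact Or.inr (.up _ _ (I.A_L h' h hab.symm))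
    | down _ hz h' =>
      rcases I.L_L h h' with rfl | hA
      · exact Or.inl rfl
      · exact Or.inr (.same _ _ hA)
    | up _ hz h' => exact absurd hab.symm (LevelInv.not_near h' h)
  | up hx hy h =>
    rename_i n x y
    obtain ⟨P, I⟩ := levelInv' (u := u) hΓ n
    cases hb with
    | same _ hz h' => exact Or.inr (.down _ _ (I.nextL_of_near hΓ h h' hab))
    | down _ hz h' => exact absurd hab (LevelInv.not_near h h')
    | up _ hz h' =>
      rcases I.eq_or_A_of_common hΓ h h' hab with rfl | hA
      · exact Or.inl rfl
      · exact Or.inr (.same _ _ hA)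

theorem devAdj_symm (hΓ : ShortCyclesHaveDiagonals Γ) {e e' : DevVertex Γ u}
    (h : DevAdj Γ u e e') : DevAdj Γ u e' e := by
  cases h with
  | same hx hy h =>
    obtain ⟨P, I⟩ := levelInv' (u := u) hΓ _
    exact .same _ _ (I.A_symm h)
  | down hx hy h => exact .up _ _ h
  | up hx hy h => exact .down _ _ h

theorem devAdj_adj (hΓ : ShortCyclesHaveDiagonals Γ) {e e' : DevVertex Γ u}
    (h : DevAdj Γ u e e') : Γ.Adj (devMap Γ u e) (devMap Γ u e') := by
  cases h with
  | same hx hy h =>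
    obtain ⟨P, I⟩ := levelInv' (u := u) hΓ _
    exact I.A_adj h
  | down hx hy h => exact (levelInv Γ u hΓ _).L_adj h
  | up hx hy h => exact ((levelInv Γ u hΓ _).L_adj h).symm

/-- An admissible z lifts to the next level. Otherwise z is near some w below y; it is then lifted
from w by induction, and the star of w contains the edge from y to that lift. -/
theorem devAdj_surj (hΓ : ShortCyclesHaveDiagonals Γ) {e : DevVertex Γ u} {z : V}
    (h : Γ.Adj (devMap Γ u e) z) : ∃ e', DevAdj Γ u e e' ∧ devMap Γ u e' = z := by
  obtain ⟨⟨n, y⟩, hy⟩ := e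
  induction n generalizing y with
  | zero =>
    obtain ⟨P, I⟩ := levelInv' (u := u) hΓ 0
    obtain ⟨x, hx, hz⟩ := I.exists_nextL hΓ ⟨hy, h, fun _ hw => False.elim hw⟩
    exact ⟨⟨(1, x), hx.1⟩, .up _ _ hx, hz⟩
  | succ n ih =>
    have I := levelInv Γ u hΓ n
    by_cases hadm : Adm Γ u (level Γ u (n + 1)) y z
    · obtain ⟨x, hx, hz⟩ := I.exists_nextL hΓ hadm
      exact ⟨⟨(n + 2, x), hx.1⟩, .up _ _ hx, hz⟩
    · obtain ⟨w, hw, hzw⟩ : ∃ w, (level Γ u (n + 1)).L y w ∧ Near Γ z (headV u w) := by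
        by_contra! hcon
        exact hadm ⟨hy, h, hcon⟩
      have hwy : DevAdj Γ u ⟨(n, w), I.L_mem' hw⟩ ⟨(n + 1, y), hy⟩ := .up _ _ hw
      rcases hzw with rfl | hzw
      · exact ⟨_, devAdj_symm hΓ hwy, rfl⟩
      · obtain ⟨e', he', hz⟩ := ih w (I.L_mem' hw) hzw.symm
        refine ⟨e', ?_, hz⟩
        refine (devAdj_star hΓ hwy he' (by rw [hz]; exact Or.inr h)).resolve_left ?_
        rintro rfl
        rw [hz] at h
        exact h.ne rfl

theorem devAdj_isStarCovering (hΓ : ShortCyclesHaveDiagonals Γ) :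
    IsStarCovering Γ (devMap Γ u) (DevAdj Γ u) where
  symm := devAdj_symm hΓ
  adj := devAdj_adj hΓ
  star := devAdj_star hΓ
  surj := devAdj_surj hΓ

/-- The base vertex of the development. -/
def devBase : DevVertex Γ u := ⟨(0, [u]), rfl⟩

theorem exists_devAdj_down {n : ℕ} {x : List V} (hx : x ∈ (level Γ u (n + 1)).S) :
    ∃ (y : List V) (hy : y ∈ (level Γ u n).S), DevAdj Γ u ⟨(n, y), hy⟩ ⟨(n + 1, x), hx⟩ := by
  obtain ⟨z, y, rfl, h, hmin⟩ := id hx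
  exact ⟨y, h.1, .up _ _ ⟨hx, z, y, rfl, h, Or.inl rfl⟩⟩

theorem reflTransGen_devBase_and_exists_walk (hΓ : ShortCyclesHaveDiagonals Γ) (n : ℕ) :
    ∀ (x : List V) (hx : x ∈ (level Γ u n).S),
      Relation.ReflTransGen (DevAdj Γ u) devBase ⟨(n, x), hx⟩ ∧
      ∃ p : Γ.Walk u (devMap Γ u ⟨(n, x), hx⟩), p.length = n := by
  induction n with
  | zero =>
    intro x hx
    obtain rfl : x = [u] := hx
    exact ⟨.refl, SimpleGraph.Walk.nil, rfl⟩
  | succ n ih =>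
    intro x hx
    obtain ⟨y, hy, hN⟩ := exists_devAdj_down hx
    obtain ⟨h₁, p, hp⟩ := ih y hy
    exact ⟨h₁.tail hN, p.concat (devAdj_adj hΓ hN), by simp [hp]⟩

theorem level_le_of_lifts {x y : V} {p : Γ.Walk x y} {e e' : DevVertex Γ u}
    (h : Lifts (devMap Γ u) (DevAdj Γ u) p e e') : e'.1.1 ≤ e.1.1 + p.length := by
  induction p generalizing e with
  | nil => rw [h.1]; simp
  | cons _ p ih =>
    obtain ⟨_, a, ha, h⟩ := h
    have := ih h
    have ha' : a.1.1 ≤ e.1.1 + 1 := by cases ha <;> (simp; try omega)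
    rw [SimpleGraph.Walk.length_cons]
    omega

variable {X : AbstractSimplicialComplex V}

/-- A geodesic from u lifts to a path from the base, which climbs at most one level per edge. By
injectivity its end is e itself, so the level of e is at most the distance; descending level by
level gives the converse. -/
theorem dist_devMap (hX : IsSimplyConnected X) (hΓ : ShortCyclesHaveDiagonals (skeleton X))
    (e : DevVertex (skeleton X) u) : (skeleton X).dist u (devMap _ u e) = e.1.1 := by
  obtain ⟨⟨n, x⟩, hx⟩ := e
  obtain ⟨-, p, hp⟩ := reflTransGen_devBase_and_exists_walk hΓ n x hx
  refine le_antisymm ((SimpleGraph.dist_le p).trans hp.le) ?_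
  obtain ⟨q, hq⟩ := hX.1.exists_walk_length_eq_dist u (devMap _ u ⟨(n, x), hx⟩)
  have hcov := devAdj_isStarCovering (u := u) hΓ
  obtain ⟨e', he'⟩ := hcov.exists_lifts q devBase rfl
  have hinj := hcov.injective hX.2 devBase
    (fun e => (reflTransGen_devBase_and_exists_walk hΓ e.1.1 e.1.2 e.2).1)
  have := level_le_of_lifts he'
  rw [hinj he'.target, hq] at this
  simpa [devBase] using this

theorem devMap_surjective (hX : IsSimplyConnected X)
    (hΓ : ShortCyclesHaveDiagonals (skeleton X)) : Function.Surjective (devMap (skeleton X) u) := by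
  intro z
  obtain ⟨q, -⟩ := hX.1.exists_walk_length_eq_dist u z
  obtain ⟨e', he'⟩ := (devAdj_isStarCovering (u := u) hΓ).exists_lifts q devBase rfl
  exact ⟨e', he'.target⟩

end Development

/-- The distance condition satisfied by the 1-skeleta of systolic complexes: adjacent vertices
at the same distance from `u` have a common neighbour closer to `u`. -/
def TriangleCondition {V : Type*} (Γ : SimpleGraph V) : Prop :=
  ∀ (u x y : V) (n : ℕ), Γ.Adj x y → Γ.dist u x = n + 1 → Γ.dist u y = n + 1 →
    ∃ w, Γ.Adj x w ∧ Γ.Adj y w ∧ Γ.dist u w = n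

/-- The neighbours of a vertex which are closer to `u` form a clique. -/
def CliqueCondition {V : Type*} (Γ : SimpleGraph V) : Prop :=
  ∀ (u x y y' : V) (n : ℕ), Γ.dist u x = n + 1 → Γ.Adj x y → Γ.Adj x y' → Γ.dist u y = n →
    Γ.dist u y' = n → Near Γ y y'

/-- Both conditions are part of the invariant of the levels (`exists_lower` and `L_L`), transported
through the bijective projection of the development. -/
theorem triangleCondition_and_cliqueCondition {V : Type*} {X : AbstractSimplicialComplex V}
    (hX : IsSimplyConnected X) (hΓ : ShortCyclesHaveDiagonals (skeleton X)) :
    TriangleCondition (skeleton X) ∧ CliqueCondition (skeleton X) := by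
  have key : ∀ (u : V) {e : DevVertex (skeleton X) u} {z : V},
      (skeleton X).Adj (devMap _ u e) z → ∃ e', DevAdj _ u e e' ∧ devMap _ u e' = z :=
    fun u e z h => devAdj_surj hΓ h
  constructor
  · intro u x y n hxy hx hy
    obtain ⟨e, rfl⟩ := devMap_surjective (u := u) hX hΓ x
    obtain ⟨e', he', rfl⟩ := key u hxy
    rw [dist_devMap hX hΓ] at hx hy
    cases he' with
    | same hx' hy' h =>
      obtain rfl : _ = n + 1 := hx
      have I := levelInv _ u hΓ n
      obtain ⟨w, hw, hw'⟩ := I.exists_lower h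
      refine ⟨headV u w, I.L_adj hw, I.L_adj hw', dist_devMap hX hΓ ⟨(n, w), I.L_mem' hw⟩⟩
    | down => simp at hx hy; omega
    | up => simp at hx hy; omega
  · intro u x y y' n hx hxy hxy' hy hy'
    obtain ⟨e, rfl⟩ := devMap_surjective (u := u) hX hΓ x
    obtain ⟨e₁, h₁, rfl⟩ := key u hxy
    obtain ⟨e₂, h₂, rfl⟩ := key u hxy'
    rw [dist_devMap hX hΓ] at hx hy hy'
    cases h₁ with
    | same => simp at hx hy; omega
    | up => simp at hx hy; omega
    | down hx' hy'' h =>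
      cases h₂ with
      | same => simp at hx hy'; omega
      | up => simp at hx hy'; omega
      | down _ _ h' => exact (levelInv _ u hΓ _).near_of_L_L h h'

/-- The properties of the 1-skeleton of an 18-systolic complex that are used below. -/
structure IsSystolicGraph {V : Type*} (Γ : SimpleGraph V) : Prop where
  conn : Γ.Connected
  cycles : ShortCyclesHaveDiagonals Γ
  tri : TriangleCondition Γ
  clique : CliqueCondition Γ

/-- Geodesic convexity of a set of vertices. -/
def IsConvex {V : Type*} (Γ : SimpleGraph V) (K : Set V) : Prop :=
  ∀ a ∈ K, ∀ b ∈ K, ∀ m, Γ.dist a m + Γ.dist m b = Γ.dist a b → m ∈ K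

/-- The distance of a vertex to a set of vertices. -/
noncomputable def lev {V : Type*} (Γ : SimpleGraph V) (K : Set V) (x : V) : ℕ :=
  sInf (Γ.dist x '' K)

/-! ### Geodesics and the distance to a set -/

section Metric

variable {V : Type*} {Γ : SimpleGraph V}

theorem Near.dist_le (x y : V) (h : Near Γ x y) : Γ.dist x y ≤ 1 := by
  rcases h with rfl | h
  · simp
  · exact (SimpleGraph.dist_eq_one_iff_adj.2 h).le

theorem near_of_dist_le (hc : Γ.Connected) {x y : V} (h : Γ.dist x y ≤ 1) : Near Γ x y := by
  rcases Nat.le_one_iff_eq_zero_or_eq_one.1 h with h | h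
  · exact Or.inl (hc.dist_eq_zero_iff.1 h)
  · exact Or.inr (SimpleGraph.dist_eq_one_iff_adj.1 h)

theorem exists_dist_add (hc : Γ.Connected) {x y : V} {m n : ℕ} (h : Γ.dist x y = m + n) :
    ∃ z, Γ.dist x z = m ∧ Γ.dist z y = n := by
  obtain ⟨w, hw⟩ := hc.exists_walk_length_eq_dist x y
  have h₁ := SimpleGraph.dist_le (w.take m)
  have h₂ := SimpleGraph.dist_le (w.drop m)
  have h₃ := hc.dist_triangle (u := x) (v := w.getVert m) (w := y)
  rw [SimpleGraph.Walk.take_length] at h₁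
  rw [SimpleGraph.Walk.drop_length] at h₂
  exact ⟨w.getVert m, by omega, by omega⟩

theorem exists_adj_dist (hc : Γ.Connected) {x y : V} {n : ℕ} (h : Γ.dist x y = n + 1) :
    ∃ z, Γ.Adj x z ∧ Γ.dist z y = n := by
  obtain ⟨z, h₁, h₂⟩ := exists_dist_add hc (h.trans (add_comm n 1))
  exact ⟨z, SimpleGraph.dist_eq_one_iff_adj.1 h₁, h₂⟩

theorem exists_geodesic (hc : Γ.Connected) (x y : V) :
    ∃ w : Γ.Walk x y, w.length = Γ.dist x y ∧
      ∀ m ∈ w.support, Γ.dist x m + Γ.dist m y = Γ.dist x y := by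
  obtain ⟨w, hw⟩ := hc.exists_walk_length_eq_dist x y
  refine ⟨w, hw, fun m hm => ?_⟩
  obtain ⟨i, rfl, hi⟩ := SimpleGraph.Walk.mem_support_iff_exists_getVert.1 hm
  have h₁ := SimpleGraph.dist_le (w.take i)
  have h₂ := SimpleGraph.dist_le (w.drop i)
  have h₃ := hc.dist_triangle (u := x) (v := w.getVert i) (w := y)
  rw [SimpleGraph.Walk.take_length] at h₁
  rw [SimpleGraph.Walk.drop_length] at h₂
  omega

theorem exists_walk_of_near {a a' b b' : V} (ha : Near Γ a a') (hb : Near Γ b b')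
    (q : Γ.Walk a' b') : ∃ w : Γ.Walk a b, w.length ≤ q.length + 2 ∧
      ∀ x ∈ w.support, x = a ∨ x = b ∨ x ∈ q.support := by
  have h₁ : ∃ w : Γ.Walk a b', w.length ≤ q.length + 1 ∧
      ∀ x ∈ w.support, x = a ∨ x ∈ q.support := by
    rcases ha with rfl | ha
    · exact ⟨q, by omega, fun x hx => Or.inr hx⟩
    · exact ⟨SimpleGraph.Walk.cons ha q, by simp, fun x hx => by simpa using hx⟩
  obtain ⟨w, hw, hs⟩ := h₁
  rcases hb with rfl | hb
  · exact ⟨w, by omega, fun x hx => (hs x hx).imp_right Or.inr⟩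
  · refine ⟨w.concat hb.symm, by simp; omega, fun x hx => ?_⟩
    rw [SimpleGraph.Walk.support_concat] at hx
    simp only [List.mem_append, List.mem_singleton] at hx
    rcases hx with hx | hx
    · exact (hs x hx).imp_right Or.inr
    · exact Or.inr (Or.inl hx)

variable {K : Set V}

theorem lev_le {k : V} (hk : k ∈ K) (x : V) : lev Γ K x ≤ Γ.dist x k :=
  Nat.sInf_le ⟨k, hk, rfl⟩

theorem exists_dist_eq_lev (hK : K.Nonempty) (x : V) : ∃ k ∈ K, Γ.dist x k = lev Γ K x :=
  Nat.sInf_mem (hK.image _)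

theorem lev_le_add (hc : Γ.Connected) (hK : K.Nonempty) (x y : V) :
    lev Γ K x ≤ Γ.dist x y + lev Γ K y := by
  obtain ⟨k, hk, h⟩ := exists_dist_eq_lev (Γ := Γ) hK y
  have := lev_le (Γ := Γ) hk x
  have := hc.dist_triangle (u := x) (v := y) (w := k)
  omega

theorem lev_le_of_near (hc : Γ.Connected) (hK : K.Nonempty) {x y : V} (h : Near Γ x y) :
    lev Γ K x ≤ lev Γ K y + 1 := by
  have := lev_le_add hc hK x y
  have := h.dist_le
  omega

theorem lev_of_mem {x : V} (h : x ∈ K) : lev Γ K x = 0 := by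
  have := lev_le (Γ := Γ) h x
  simpa using this

theorem mem_of_lev (hc : Γ.Connected) (hK : K.Nonempty) {x : V} (h : lev Γ K x = 0) : x ∈ K := by
  obtain ⟨k, hk, hx⟩ := exists_dist_eq_lev (Γ := Γ) hK x
  rw [h, hc.dist_eq_zero_iff] at hx
  exact hx ▸ hk

theorem exists_lower_neighbor (hc : Γ.Connected) (hK : K.Nonempty) {x : V} {n : ℕ}
    (h : lev Γ K x = n + 1) : ∃ y, Γ.Adj x y ∧ lev Γ K y = n := by
  obtain ⟨k, hk, hx⟩ := exists_dist_eq_lev (Γ := Γ) hK x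
  obtain ⟨y, hxy, hy⟩ := exists_adj_dist hc (hx.trans h)
  have := lev_le (Γ := Γ) hk y
  have := lev_le_of_near hc hK (Or.inr hxy)
  exact ⟨y, hxy, by omega⟩

end Metric

/-! ### Convexity: from local to global, neighbourhoods and balls -/

namespace IsSystolicGraph

variable {V : Type*} {Γ : SimpleGraph V} (hΓ : IsSystolicGraph Γ) {K : Set V}
include hΓ

/-- Induction on the length of a walk inside K. The interval from its second vertex x to b lies in K
by induction, and the cases compare the distances of a and x to b. -/
theorem interval_subset_of_walk
    (h₂ : ∀ a ∈ K, ∀ b ∈ K, ∀ m, Γ.Adj m a → Γ.Adj m b → Near Γ a b ∨ m ∈ K) (n : ℕ) :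
    ∀ {a b : V} (w : Γ.Walk a b), w.length ≤ n → (∀ x ∈ w.support, x ∈ K) →
      ∀ m, Γ.dist a m + Γ.dist m b = Γ.dist a b → m ∈ K := by
  have tri : ∀ {x y z : V}, Γ.dist x z ≤ Γ.dist x y + Γ.dist y z := hΓ.conn.dist_triangle
  induction n with
  | zero =>
    intro a b w hw hwK m hm
    obtain rfl := SimpleGraph.Walk.eq_of_length_eq_zero (Nat.le_zero.1 hw)
    obtain rfl : a = m := hΓ.conn.dist_eq_zero_iff.1 (by rw [SimpleGraph.dist_self] at hm; omega)
    exact hwK _ (by simp)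
  | succ n ih =>
    intro a b w hw hwK m hm
    by_cases ham : a = m
    · exact ham ▸ hwK _ (by simp)
    cases w with
    | nil =>
      exact absurd (hΓ.conn.dist_eq_zero_iff.1 (by rw [SimpleGraph.dist_self] at hm; omega)) ham
    | @cons _ x _ hax p =>
      rw [SimpleGraph.Walk.length_cons] at hw
      have ihx := ih p (by omega) (fun y hy => hwK y (by simp [hy]))
      have hxn := SimpleGraph.dist_le p
      have h1 : Γ.dist a x = 1 := SimpleGraph.dist_eq_one_iff_adj.2 hax
      have h1' : Γ.dist x a = 1 := SimpleGraph.dist_eq_one_iff_adj.2 hax.symm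
      have haK : a ∈ K := hwK a (by simp)
      have t₁ := tri (x := a) (y := x) (z := b)
      have t₂ := tri (x := x) (y := a) (z := b)
      have t₃ := tri (x := x) (y := a) (z := m)
      have t₄ := tri (x := x) (y := m) (z := b)
      rcases (by omega : Γ.dist a b + 1 = Γ.dist x b ∨ Γ.dist a b = Γ.dist x b ∨
        Γ.dist a b = Γ.dist x b + 1) with hd | hd | hd
      · exact ihx m (by omega)
      · rcases he : Γ.dist x b with _ | e
        · exact absurd (hΓ.conn.dist_eq_zero_iff.1 (by omega)) ham
        -- A common neighbour w of a and x closer to b allows the walk to be replaced by a geodesic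
        -- from a through w, which stays in K and is shorter.
        obtain ⟨w, haw, hxw, hw'⟩ := hΓ.tri b a x e hax (by rw [SimpleGraph.dist_comm]; omega)
          (by rw [SimpleGraph.dist_comm]; omega)
        rw [SimpleGraph.dist_comm] at hw'
        obtain ⟨q, hq, hqs⟩ := exists_geodesic hΓ.conn w b
        have hxw1 : Γ.dist x w = 1 := SimpleGraph.dist_eq_one_iff_adj.2 hxw
        refine ih (SimpleGraph.Walk.cons haw q) (by simp; omega) ?_ m hm
        intro y hy
        rw [SimpleGraph.Walk.support_cons, List.mem_cons] at hy
        rcases hy with rfl | hy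
        · exact haK
        · have := hqs y hy
          have := tri (x := x) (y := w) (z := y)
          have := tri (x := x) (y := y) (z := b)
          exact ihx y (by omega)
      · have ham' : Γ.dist a m ≠ 0 := fun h => ham (hΓ.conn.dist_eq_zero_iff.1 h)
        obtain ⟨z, haz, hzm⟩ := exists_adj_dist hΓ.conn
          (show Γ.dist a m = (Γ.dist a m - 1) + 1 by omega)
        have haz1 : Γ.dist a z = 1 := SimpleGraph.dist_eq_one_iff_adj.2 haz
        have := tri (x := z) (y := m) (z := b)
        have := tri (x := a) (y := z) (z := b)
        have hzb : Γ.dist z b = Γ.dist x b := by omega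
        rcases hΓ.clique b a z x (Γ.dist x b) (by rw [SimpleGraph.dist_comm]; omega) haz hax
          (by rw [SimpleGraph.dist_comm]; omega) (by rw [SimpleGraph.dist_comm]) with rfl | hzx
        · exact ihx m (by omega)
        rcases he : Γ.dist x b with _ | e
        · have h₁ := hΓ.conn.dist_eq_zero_iff.1 he
          have h₂ := hΓ.conn.dist_eq_zero_iff.1 (hzb.trans he)
          exact absurd (h₂.trans h₁.symm) hzx.ne
        obtain ⟨w, hzw, hxw, hw'⟩ := hΓ.tri b z x e hzx (by rw [SimpleGraph.dist_comm]; omega)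
          (by rw [SimpleGraph.dist_comm]; omega)
        rw [SimpleGraph.dist_comm] at hw'
        have hxw1 : Γ.dist x w = 1 := SimpleGraph.dist_eq_one_iff_adj.2 hxw
        have hwK' : w ∈ K := ihx w (by omega)
        -- The vertices a and w of K are at distance two with common neighbour z, so local convexity
        -- applies.
        have hzK : z ∈ K := by
          refine (h₂ a haK w hwK' z haz.symm hzw).resolve_left fun h => ?_
          have := h.dist_le
          have := tri (x := a) (y := w) (z := b)
          omega
        obtain ⟨q, hq, hqs⟩ := exists_geodesic hΓ.conn w b
        refine ih (SimpleGraph.Walk.cons hzw q) (by simp; omega) ?_ m (by omega)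
        intro y hy
        rw [SimpleGraph.Walk.support_cons, List.mem_cons] at hy
        rcases hy with rfl | hy
        · exact hzK
        · have := hqs y hy
          have := tri (x := x) (y := w) (z := y)
          have := tri (x := x) (y := y) (z := b)
          exact ihx y (by omega)

/-- Connected and locally convex sets are convex. -/
theorem isConvex_of_local
    (hconn : ∀ a ∈ K, ∀ b ∈ K, ∃ w : Γ.Walk a b, ∀ x ∈ w.support, x ∈ K)
    (h₂ : ∀ a ∈ K, ∀ b ∈ K, ∀ m, Γ.Adj m a → Γ.Adj m b → Near Γ a b ∨ m ∈ K) :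
    IsConvex Γ K := by
  intro a ha b hb m hm
  obtain ⟨w, hw⟩ := hconn a ha b hb
  exact hΓ.interval_subset_of_walk h₂ w.length w le_rfl hw m hm

omit hΓ in
theorem _root_.Systolic.IsConvex.mem_of_adj (hK : IsConvex Γ K) {a b m : V} (hc : Γ.Connected)
    (ha : a ∈ K) (hb : b ∈ K) (hma : Γ.Adj m a) (hmb : Γ.Adj m b) (hab : ¬ Near Γ a b) :
    m ∈ K := by
  refine hK a ha b hb m ?_
  have h₁ := SimpleGraph.dist_eq_one_iff_adj.2 hma.symm
  have h₂ := SimpleGraph.dist_eq_one_iff_adj.2 hmb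
  have h₃ := hc.dist_triangle (u := a) (v := m) (w := b)
  have h₄ : ¬ Γ.dist a b ≤ 1 := fun h => hab (near_of_dist_le hc h)
  omega

/-- The neighbourhood of a convex set is convex. -/
theorem isConvex_neighborhood (hK : IsConvex Γ K) : IsConvex Γ {x | ∃ y ∈ K, Near Γ x y} := by
  refine hΓ.isConvex_of_local ?_ ?_
  · rintro a ⟨a', ha', haa⟩ b ⟨b', hb', hbb⟩
    obtain ⟨q, -, hq⟩ := exists_geodesic hΓ.conn a' b'
    obtain ⟨w, -, hw⟩ := exists_walk_of_near haa hbb q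
    refine ⟨w, fun x hx => ?_⟩
    rcases hw x hx with rfl | rfl | hx
    · exact ⟨a', ha', haa⟩
    · exact ⟨b', hb', hbb⟩
    · exact ⟨x, hK a' ha' b' hb' x (hq x hx), Near.refl x⟩
  · rintro a ⟨a', ha', haa⟩ b ⟨b', hb', hbb⟩ m hma hmb
    by_contra! hcon
    obtain ⟨hab, hm⟩ := hcon
    have hm' : ∀ y ∈ K, ¬ Near Γ m y := fun y hy h => hm ⟨y, hy, h⟩
    obtain ⟨q, hql, hq⟩ := exists_geodesic hΓ.conn a' b'
    have hqK : ∀ x ∈ q.support, x ∈ K := fun x hx => hK a' ha' b' hb' x (hq x hx)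
    obtain ⟨w, hwl, hw⟩ := exists_walk_of_near haa hbb q
    have h₁ := haa.symm.dist_le
    have h₂ := hbb.dist_le
    have h₃ := (Near.of_adj hma.symm).dist_le
    have h₄ := (Near.of_adj hmb).dist_le
    have t₁ := hΓ.conn.dist_triangle (u := a') (v := a) (w := b')
    have t₂ := hΓ.conn.dist_triangle (u := a) (v := m) (w := b')
    have t₃ := hΓ.conn.dist_triangle (u := m) (v := b) (w := b')
    -- Since a' and b' are at distance at most 4, the walk has at most 6 edges, and the cycle
    -- through m at most 8.
    obtain ⟨c, hc, hca, hcb, hmc⟩ := exists_adj_of_walk hΓ.cycles hma hmb hab w (fun h => by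
      rcases hw m h with rfl | rfl | h
      · exact hma.ne rfl
      · exact hmb.ne rfl
      · exact hm' m (hqK m h) (Near.refl m)) (by omega)
    rcases hw c hc with rfl | rfl | h
    · exact hca rfl
    · exact hcb rfl
    · exact hm' c (hqK c h) (Or.inr hmc)

/-- Balls around convex sets are convex. -/
theorem isConvex_lev_le (hK : IsConvex Γ K) (hne : K.Nonempty) (n : ℕ) :
    IsConvex Γ {x | lev Γ K x ≤ n} := by
  induction n with
  | zero =>
    convert hK using 1
    ext x
    exact ⟨fun h => mem_of_lev hΓ.conn hne (Nat.le_zero.1 h), fun h => (lev_of_mem h).le⟩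
  | succ n ih =>
    convert hΓ.isConvex_neighborhood ih using 1
    ext x
    constructor
    · intro h
      rcases Nat.lt_or_ge n (lev Γ K x) with h' | h'
      · obtain ⟨y, hxy, hy⟩ := exists_lower_neighbor hΓ.conn hne
          (le_antisymm h h' : lev Γ K x = n + 1)
        exact ⟨y, hy.le, Or.inr hxy⟩
      · exact ⟨x, h', Near.refl x⟩
    · rintro ⟨y, hy, hxy⟩
      have := lev_le_of_near hΓ.conn hne hxy
      exact this.trans (Nat.succ_le_succ hy)

theorem lev_le_max (hK : IsConvex Γ K) (hne : K.Nonempty) {a b m : V} {n : ℕ}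
    (ha : lev Γ K a ≤ n) (hb : lev Γ K b ≤ n) (hm : Γ.dist a m + Γ.dist m b = Γ.dist a b) :
    lev Γ K m ≤ n :=
  hΓ.isConvex_lev_le hK hne n a ha b hb m hm

theorem lev_clique (hK : IsConvex Γ K) (hne : K.Nonempty) {x a b : V} {n : ℕ}
    (hx : lev Γ K x = n + 1) (hxa : Γ.Adj x a) (hxb : Γ.Adj x b) (ha : lev Γ K a = n)
    (hb : lev Γ K b = n) : Near Γ a b := by
  by_contra hab
  have : lev Γ K x ≤ n :=
    (hΓ.isConvex_lev_le hK hne n).mem_of_adj hΓ.conn ha.le hb.le hxa hxb hab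
  omega

/-- Induction on the distance between lower neighbours a' of a and b' of b. A geodesic between them
stays in the convex ball of radius n, so a diagonal at a ends at a lower neighbour of a that is
closer to b'. -/
theorem lev_triangle (hK : IsConvex Γ K) (hne : K.Nonempty) {a b : V} {n : ℕ} (hab : Γ.Adj a b)
    (ha : lev Γ K a = n + 1) (hb : lev Γ K b = n + 1) :
    ∃ w, Γ.Adj a w ∧ Γ.Adj b w ∧ lev Γ K w = n := by
  obtain ⟨a', haa, ha'⟩ := exists_lower_neighbor hΓ.conn hne ha
  obtain ⟨b', hbb, hb'⟩ := exists_lower_neighbor hΓ.conn hne hb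
  induction h : Γ.dist a' b' using Nat.strong_induction_on generalizing a' with
  | _ k ih =>
    subst h
    by_cases hab' : Near Γ a' b
    · refine ⟨a', haa, ?_, ha'⟩
      rcases hab' with rfl | h
      · omega
      · exact h.symm
    obtain ⟨q, hql, hq⟩ := exists_geodesic hΓ.conn a' b'
    have hqn : ∀ x ∈ q.support, lev Γ K x ≤ n := fun x hx =>
      hΓ.lev_le_max hK hne ha'.le hb'.le (hq x hx)
    obtain ⟨w, hwl, hw⟩ := exists_walk_of_near (Near.refl a') (Or.inr hbb) q
    have h₁ := (Near.of_adj haa.symm).dist_le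
    have h₂ := (Near.of_adj hab).dist_le
    have h₃ := (Near.of_adj hbb).dist_le
    have t₁ := hΓ.conn.dist_triangle (u := a') (v := a) (w := b')
    have t₂ := hΓ.conn.dist_triangle (u := a) (v := b) (w := b')
    obtain ⟨c, hc, hca, hcb, hac⟩ := exists_adj_of_walk hΓ.cycles haa hab hab' w (fun h => by
      rcases hw a h with rfl | rfl | h
      · exact haa.ne rfl
      · exact hab.ne rfl
      · have := hqn a h
        omega) (by omega)
    rcases hw c hc with rfl | rfl | h
    · exact absurd rfl hca
    · exact absurd rfl hcb
    · have hcn := hqn c h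
      have := lev_le_of_near hΓ.conn hne (Or.inr hac)
      have hcd := hq c h
      have : Γ.dist a' c ≠ 0 := fun h => hca (hΓ.conn.dist_eq_zero_iff.1 h).symm
      exact ih (Γ.dist c b') (by omega) c hac (by omega) rfl

end IsSystolicGraph

/-! ### Flat paths and shadows -/

section Defs

variable {V : Type*} (Γ : SimpleGraph V) (K : Set V)

/-- `Flat Γ K n k x y`: there is a chain of at most `k` edges from `x` to `y` at distance `n`
from `K`. -/
def Flat (n : ℕ) : ℕ → V → V → Prop
  | 0, x, y => x = y ∧ lev Γ K x = n
  | k + 1, x, y => lev Γ K x = n ∧ ∃ z, Near Γ x z ∧ Flat n k z y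

/-- The vertex `p` lies on a geodesic from `x` to a nearest point of `K`. -/
def Shadow (x p : V) : Prop := Γ.dist x p + lev Γ K p = lev Γ K x

/-- The sequence `v` is a geodesic on `[0, L]`. -/
def IsGeodesic (v : ℕ → V) (L : ℕ) : Prop :=
  ∀ i j, i ≤ j → j ≤ L → Γ.dist (v i) (v j) = j - i

end Defs

section Basic

variable {V : Type*} {Γ : SimpleGraph V} {K : Set V} {n k l : ℕ} {x y z p q : V}

theorem Flat.lev_left (h : Flat Γ K n k x y) : lev Γ K x = n := by
  cases k with
  | zero => exact h.2
  | succ k => exact h.1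

theorem Flat.lev_right (h : Flat Γ K n k x y) : lev Γ K y = n := by
  induction k generalizing x with
  | zero => exact h.1 ▸ h.2
  | succ k ih =>
    obtain ⟨_, z, _, h⟩ := h
    exact ih h

theorem flat_one (h : Near Γ x y) (hx : lev Γ K x = n) (hy : lev Γ K y = n) :
    Flat Γ K n 1 x y := ⟨hx, y, h, rfl, hy⟩

theorem Flat.append (h : Flat Γ K n k x y) (h' : Flat Γ K n l y z) : Flat Γ K n (l + k) x z := by
  induction k generalizing x with
  | zero => exact h.1 ▸ h'
  | succ k ih =>
    obtain ⟨hx, w, hw, h⟩ := h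
    exact ⟨hx, w, hw, ih h⟩

theorem Flat.symm (h : Flat Γ K n k x y) : Flat Γ K n k y x := by
  induction k generalizing x with
  | zero => exact ⟨h.1.symm, h.1 ▸ h.2⟩
  | succ k ih =>
    obtain ⟨hx, w, hw, h⟩ := h
    have := (ih h).append (flat_one hw.symm h.lev_left hx)
    rwa [add_comm] at this

theorem Flat.mono (h : Flat Γ K n k x y) (hkl : k ≤ l) : Flat Γ K n l x y := by
  obtain ⟨m, rfl⟩ := Nat.exists_eq_add_of_le hkl
  have hz : ∀ m, Flat Γ K n m y y := by
    intro m
    induction m with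
    | zero => exact ⟨rfl, h.lev_right⟩
    | succ m ih => exact ⟨h.lev_right, y, Near.refl y, ih⟩
  have := h.append (hz m)
  rwa [add_comm] at this

theorem Flat.dist_le (hc : Γ.Connected) (h : Flat Γ K n k x y) : Γ.dist x y ≤ k := by
  induction k generalizing x with
  | zero => simp [h.1]
  | succ k ih =>
    obtain ⟨_, w, hw, h⟩ := h
    have := ih h
    have := hw.dist_le
    have := hc.dist_triangle (u := x) (v := w) (w := y)
    omega

theorem Near.adj_of_lev (h : Near Γ x y) (hne : lev Γ K x ≠ lev Γ K y) : Γ.Adj x y :=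
  h.resolve_left fun e => hne (e ▸ rfl)

theorem Shadow.refl (x : V) : Shadow Γ K x x := by simp [Shadow]

theorem Shadow.trans (hc : Γ.Connected) (hne : K.Nonempty) (h : Shadow Γ K x y)
    (h' : Shadow Γ K y z) : Shadow Γ K x z := by
  unfold Shadow at *
  have := hc.dist_triangle (u := x) (v := y) (w := z)
  have := lev_le_add hc hne x z
  omega

theorem Shadow.eq_of_lev (hc : Γ.Connected) (h : Shadow Γ K x p) (hl : lev Γ K p = lev Γ K x) :
    x = p := hc.dist_eq_zero_iff.1 (by unfold Shadow at h; omega)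

theorem Shadow.adj_of_lev (h : Shadow Γ K x p) (hl : lev Γ K x = lev Γ K p + 1) : Γ.Adj x p :=
  SimpleGraph.dist_eq_one_iff_adj.1 (by unfold Shadow at h; omega)

theorem Shadow.of_adj (h : Γ.Adj x p) (hl : lev Γ K x = lev Γ K p + 1) : Shadow Γ K x p := by
  unfold Shadow
  rw [SimpleGraph.dist_eq_one_iff_adj.2 h, hl, add_comm]

theorem Shadow.exists_between (hc : Γ.Connected) (hne : K.Nonempty) (h : Shadow Γ K x p) {s : ℕ}
    (hp : lev Γ K p ≤ s) (hs : s ≤ lev Γ K x) :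
    ∃ p', lev Γ K p' = s ∧ Shadow Γ K x p' ∧ Shadow Γ K p' p := by
  unfold Shadow at *
  obtain ⟨p', h₁, h₂⟩ := exists_dist_add hc (x := x) (y := p) (m := lev Γ K x - s)
    (n := s - lev Γ K p) (by omega)
  have := lev_le_add hc hne x p'
  have := lev_le_add hc hne p' p
  exact ⟨p', by omega, by omega, by omega⟩

theorem exists_shadow (hc : Γ.Connected) (hne : K.Nonempty) {s : ℕ} (hs : s ≤ lev Γ K x) :
    ∃ p, lev Γ K p = s ∧ Shadow Γ K x p := by
  obtain ⟨k, hk, hx⟩ := exists_dist_eq_lev (Γ := Γ) hne x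
  have h0 : lev Γ K k = 0 := lev_of_mem hk
  obtain ⟨p, h₁, h₂, -⟩ := Shadow.exists_between hc hne (p := k) (x := x)
    (by unfold Shadow; omega) (s := s) (by omega) hs
  exact ⟨p, h₁, h₂⟩

theorem exists_isGeodesic (hc : Γ.Connected) (x y : V) :
    ∃ v : ℕ → V, v 0 = x ∧ v (Γ.dist x y) = y ∧ IsGeodesic Γ v (Γ.dist x y) := by
  obtain ⟨w, hw⟩ := hc.exists_walk_length_eq_dist x y
  refine ⟨w.getVert, w.getVert_zero, by rw [← hw]; exact w.getVert_length, ?_⟩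
  intro i j hij hj
  have h₁ := SimpleGraph.dist_le (w.take i)
  have h₂ := SimpleGraph.dist_le (w.drop j)
  have h₃ := SimpleGraph.dist_le ((w.drop i).take (j - i))
  rw [SimpleGraph.Walk.take_length] at h₁ h₃
  rw [SimpleGraph.Walk.drop_length] at h₂
  rw [SimpleGraph.Walk.drop_getVert, Nat.add_sub_cancel' hij] at h₃
  have t₁ := hc.dist_triangle (u := x) (v := w.getVert i) (w := y)
  have t₂ := hc.dist_triangle (u := w.getVert i) (v := w.getVert j) (w := y)
  omega

theorem IsGeodesic.mono {v : ℕ → V} (h : IsGeodesic Γ v k) (hl : l ≤ k) : IsGeodesic Γ v l :=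
  fun i j hij hj => h i j hij (hj.trans hl)

theorem IsGeodesic.reverse {v : ℕ → V} (h : IsGeodesic Γ v k) :
    IsGeodesic Γ (fun i => v (k - i)) k := by
  intro i j hij hj
  have := h (k - j) (k - i) (by omega) (by omega)
  rw [SimpleGraph.dist_comm] at this
  change Γ.dist (v (k - i)) (v (k - j)) = j - i
  omega

theorem IsGeodesic.flat {v : ℕ → V} (h : IsGeodesic Γ v l) {i j : ℕ} (hij : i ≤ j) (hj : j ≤ l)
    (hv : ∀ m, i ≤ m → m ≤ j → lev Γ K (v m) = n) : Flat Γ K n (j - i) (v i) (v j) := by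
  obtain ⟨d, rfl⟩ := Nat.exists_eq_add_of_le hij
  rw [Nat.add_sub_cancel_left]
  induction d generalizing i with
  | zero => exact ⟨rfl, hv i le_rfl le_rfl⟩
  | succ d ih =>
    refine ⟨hv i le_rfl hij, v (i + 1), Or.inr ?_, ?_⟩
    · exact SimpleGraph.dist_eq_one_iff_adj.1 (by rw [h i (i + 1)] <;> omega)
    · have := ih (i := i + 1) (by omega) (by omega) fun m h₁ h₂ => hv m (by omega) (by omega)
      rwa [show i + 1 + d = i + (d + 1) by omega] at this

end Basic

/-! ### Contraction towards a convex set -/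

namespace IsSystolicGraph

variable {V : Type*} {Γ : SimpleGraph V} (hΓ : IsSystolicGraph Γ) {K : Set V}
  (hK : IsConvex Γ K) (hne : K.Nonempty) {n k : ℕ} {x y z p q : V}
include hΓ hK hne

theorem exists_common_lower (hxy : Near Γ x y) (hx : lev Γ K x = n + 1)
    (hy : lev Γ K y = n + 1) : ∃ w, Γ.Adj x w ∧ Γ.Adj y w ∧ lev Γ K w = n := by
  rcases hxy with rfl | hxy
  · obtain ⟨w, hw, hl⟩ := exists_lower_neighbor hΓ.conn hne hx
    exact ⟨w, hw, hw, hl⟩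
  · exact hΓ.lev_triangle hK hne hxy hx hy

/-- The lower neighbours of two adjacent vertices of the same level form a clique. -/
theorem near_lower (hxy : Near Γ x y) (hx : lev Γ K x = n + 2) (hy : lev Γ K y = n + 2)
    (hxp : Γ.Adj x p) (hyq : Γ.Adj y q) (hp : lev Γ K p = n + 1) (hq : lev Γ K q = n + 1) :
    Near Γ p q := by
  by_contra hpq
  obtain ⟨c, hxc, hyc, hc⟩ := hΓ.exists_common_lower hK hne hxy hx hy
  obtain ⟨d₁, hpd, hcd₁, hd₁⟩ := hΓ.exists_common_lower hK hne
    (hΓ.lev_clique hK hne hx hxp hxc hp hc) hp hc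
  obtain ⟨d₂, hqd, hcd₂, hd₂⟩ := hΓ.exists_common_lower hK hne
    (hΓ.lev_clique hK hne hy hyq hyc hq hc) hq hc
  have hdd := hΓ.lev_clique hK hne hc hcd₁ hcd₂ hd₁ hd₂
  have hfar : ∀ d, lev Γ K d = n → ¬ Near Γ x d := fun d hd h => by
    have := lev_le_of_near hΓ.conn hne h
    omega
  have hxq : ¬ Near Γ x q := fun h =>
    hpq (hΓ.lev_clique hK hne hx hxp (h.adj_of_lev (K := K) (by omega)) hp hq)
  -- In the closed chain x, p, d₁, d₂, q, y the vertex x is two levels above d₁ and d₂, so it is the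
  -- tip of an ear.
  have hpy : Near Γ p y := near_of_chain hΓ.cycles (m := x) [d₁, d₂, q] (Or.inr hxp) hxy
    (by simp [Near.of_adj hpd, hdd, Near.of_adj hqd.symm, Near.of_adj hyq.symm]) (by simp)
    (by simpa using ⟨hfar _ hd₁, hfar _ hd₂, hxq⟩)
  exact hpq (hΓ.lev_clique hK hne hy (hpy.symm.adj_of_lev (K := K) (by omega)) hyq hp hq)

/-- The lower neighbours of the end points of a flat path of length two form a clique. -/
theorem near_lower_of_two (hxy : Near Γ x y) (hyz : Near Γ y z) (hx : lev Γ K x = n + 2)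
    (hy : lev Γ K y = n + 2) (hz : lev Γ K z = n + 2) (hxp : Γ.Adj x p) (hzq : Γ.Adj z q)
    (hp : lev Γ K p = n + 1) (hq : lev Γ K q = n + 1) : Near Γ p q := by
  by_contra hpq
  obtain ⟨c, hyc, hc⟩ := exists_lower_neighbor hΓ.conn hne hy
  obtain ⟨d₁, hpd, hcd₁, hd₁⟩ := hΓ.exists_common_lower hK hne
    (hΓ.near_lower hK hne hxy hx hy hxp hyc hp hc) hp hc
  obtain ⟨d₂, hqd, hcd₂, hd₂⟩ := hΓ.exists_common_lower hK hne
    (hΓ.near_lower hK hne hyz.symm hz hy hzq hyc hq hc) hq hc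
  have hdd := hΓ.lev_clique hK hne hc hcd₁ hcd₂ hd₁ hd₂
  have hfar : ∀ d, lev Γ K d = n → ¬ Near Γ y d := fun d hd h => by
    have := lev_le_of_near hΓ.conn hne h
    omega
  have hyp : ¬ Near Γ y p := fun h => hpq (hΓ.near_lower hK hne hyz hy hz
    (h.adj_of_lev (K := K) (by omega)) hzq hp hq)
  have hyq : ¬ Near Γ y q := fun h => hpq (hΓ.near_lower hK hne hxy hx hy hxp
    (h.adj_of_lev (K := K) (by omega)) hp hq)
  -- The same argument at the middle vertex y of the path, in a chain of seven vertices, reduces to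
  -- the case of a single edge.
  have hxz : Near Γ x z := near_of_chain hΓ.cycles (m := y) [p, d₁, d₂, q] hxy.symm hyz
    (by simp [Near.of_adj hxp, Near.of_adj hpd, hdd, Near.of_adj hqd.symm, Near.of_adj hzq.symm])
    (by simp) (by simpa using ⟨hyp, hfar _ hd₁, hfar _ hd₂, hyq⟩)
  exact hpq (hΓ.near_lower hK hne hxz hx hz hxp hzq hp hq)

/-- Flat paths become half as long on the next lower level. -/
theorem flat_lower (h : Flat Γ K (n + 2) (2 * (k + 1)) x y) (hxp : Γ.Adj x p) (hyq : Γ.Adj y q)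
    (hp : lev Γ K p = n + 1) (hq : lev Γ K q = n + 1) : Flat Γ K (n + 1) (k + 1) p q := by
  induction k generalizing x p with
  | zero =>
    obtain ⟨hx, w, hw, hw', z, hz, rfl, hz'⟩ := h
    exact flat_one (hΓ.near_lower_of_two hK hne hw hz hx hw' hz' hxp hyq hp hq) hp hq
  | succ k ih =>
    obtain ⟨hx, w, hw, hw', z, hz, h⟩ := h
    obtain ⟨r, hzr, hr⟩ := exists_lower_neighbor hΓ.conn hne h.lev_left
    exact ⟨hp, r, hΓ.near_lower_of_two hK hne hw hz hx hw' h.lev_left hxp hzr hp hr, ih h hzr hr⟩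

/-- One edge down, three edges on the next level and one edge up form a shortcut. Hence geodesics
contain no flat segment of length 6. -/
theorem dist_le_five_of_flat (h : Flat Γ K (n + 2) 6 x y) : Γ.dist x y ≤ 5 := by
  obtain ⟨p, hxp, hp⟩ := exists_lower_neighbor hΓ.conn hne h.lev_left
  obtain ⟨q, hyq, hq⟩ := exists_lower_neighbor hΓ.conn hne h.lev_right
  have := (hΓ.flat_lower hK hne (k := 2) h hxp hyq hp hq).dist_le hΓ.conn
  have h₁ := (Near.of_adj hxp).dist_le
  have h₂ := (Near.of_adj hyq.symm).dist_le
  have t₁ := hΓ.conn.dist_triangle (u := x) (v := p) (w := y)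
  have t₂ := hΓ.conn.dist_triangle (u := p) (v := q) (w := y)
  omega

theorem near_shadow_of_lev_eq {j : ℕ} (hxy : Near Γ x y) (hx : lev Γ K x = n)
    (hy : lev Γ K y = n) (hp : Shadow Γ K x p) (hq : Shadow Γ K y q)
    (hpj : lev Γ K p = j + 1) (hqj : lev Γ K q = j + 1) : Near Γ p q := by
  have hjn : j + 1 ≤ n := by unfold Shadow at hp; omega
  induction n, hjn using Nat.le_induction generalizing x y with
  | base =>
    rw [← hp.eq_of_lev hΓ.conn (by omega), ← hq.eq_of_lev hΓ.conn (by omega)]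
    exact hxy
  | succ n hn ih =>
    obtain ⟨x', hx', hxx, hxp⟩ := hp.exists_between hΓ.conn hne (s := n) (by omega) (by omega)
    obtain ⟨y', hy', hyy, hyq⟩ := hq.exists_between hΓ.conn hne (s := n) (by omega) (by omega)
    obtain ⟨m, rfl⟩ := Nat.exists_eq_add_of_le' (show 1 ≤ n by omega)
    exact ih (hΓ.near_lower hK hne hxy hx hy (hxx.adj_of_lev (by omega))
      (hyy.adj_of_lev (by omega)) hx' hy') hx' hy' hxp hyq

/-- If the levels differ, the lower vertex is itself in the shadow of the higher one, so both p and
q are shadows of the higher vertex. -/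
theorem near_shadow {j : ℕ} (hxy : Near Γ x y) (hp : Shadow Γ K x p) (hq : Shadow Γ K y q)
    (hpj : lev Γ K p = j + 1) (hqj : lev Γ K q = j + 1) : Near Γ p q := by
  have h₁ := lev_le_of_near hΓ.conn hne hxy
  have h₂ := lev_le_of_near hΓ.conn hne hxy.symm
  rcases lt_trichotomy (lev Γ K x) (lev Γ K y) with h | h | h
  · have hyx : Shadow Γ K y x := Shadow.of_adj (hxy.symm.adj_of_lev (K := K) h.ne') (by omega)
    exact hΓ.near_shadow_of_lev_eq hK hne (Near.refl y) rfl rfl (hyx.trans hΓ.conn hne hp) hq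
      hpj hqj
  · exact hΓ.near_shadow_of_lev_eq hK hne hxy rfl h.symm hp hq hpj hqj
  · have hxy' : Shadow Γ K x y := Shadow.of_adj (hxy.adj_of_lev (K := K) h.ne') (by omega)
    exact hΓ.near_shadow_of_lev_eq hK hne (Near.refl x) rfl rfl hp (hxy'.trans hΓ.conn hne hq)
      hpj hqj

theorem flat_shadow_of_walk {j : ℕ} (w : Γ.Walk x y) (hw : ∀ v ∈ w.support, j + 1 ≤ lev Γ K v)
    (hp : Shadow Γ K x p) (hq : Shadow Γ K y q) (hpj : lev Γ K p = j + 1)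
    (hqj : lev Γ K q = j + 1) : Flat Γ K (j + 1) (w.length + 1) p q := by
  induction w generalizing p with
  | nil => exact flat_one (hΓ.near_shadow hK hne (Near.refl _) hp hq hpj hqj) hpj hqj
  | cons hadj w ih =>
    obtain ⟨r, hr, hs⟩ := exists_shadow hΓ.conn hne
      (hw _ (List.mem_cons_of_mem _ w.start_mem_support))
    exact ⟨hpj, r, hΓ.near_shadow hK hne (Or.inr hadj) hp hs hpj hr,
      ih (fun v hv => hw v (by simp [hv])) hs hq hr⟩

/-- Each level halves the path, so m levels reduce 2 ^ m edges to one. -/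
theorem near_shadow_of_flat {m t : ℕ} (h : Flat Γ K (t + 1 + m) (2 ^ m) x y)
    (hp : Shadow Γ K x p) (hq : Shadow Γ K y q) (hpt : lev Γ K p = t + 1)
    (hqt : lev Γ K q = t + 1) : Near Γ p q := by
  induction m generalizing x y with
  | zero =>
    rw [← hp.eq_of_lev hΓ.conn (by rw [h.lev_left, hpt]),
      ← hq.eq_of_lev hΓ.conn (by rw [h.lev_right, hqt])]
    obtain ⟨-, z, hz, rfl, -⟩ := h
    exact hz
  | succ m ih =>
    have hx := h.lev_left
    have hy := h.lev_right
    obtain ⟨x', hx', hxx, hxp⟩ := hp.exists_between hΓ.conn hne (s := t + 1 + m) (by omega)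
      (by omega)
    obtain ⟨y', hy', hyy, hyq⟩ := hq.exists_between hΓ.conn hne (s := t + 1 + m) (by omega)
      (by omega)
    obtain ⟨k, hk⟩ := Nat.exists_eq_succ_of_ne_zero (pow_ne_zero m (two_ne_zero (α := ℕ)))
    refine ih ?_ hxp hyq
    rw [hk, show t + 1 + m = t + m + 1 by omega]
    refine hΓ.flat_lower hK hne (n := t + m) (k := k) ?_ (hxx.adj_of_lev (by omega))
      (hyy.adj_of_lev (by omega)) (by omega) (by omega)
    rw [show t + m + 2 = t + 1 + (m + 1) by omega]
    convert h using 1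
    rw [pow_succ, hk, mul_comm]

/-- The shadows of two vertices joined by a path which stays far from `K` form a clique. -/
theorem near_shadow_of_walk {m t : ℕ} (w : Γ.Walk x y) (hl : w.length + 1 ≤ 2 ^ m)
    (hw : ∀ v ∈ w.support, t + 1 + m ≤ lev Γ K v) (hp : Shadow Γ K x p) (hq : Shadow Γ K y q)
    (hpt : lev Γ K p = t + 1) (hqt : lev Γ K q = t + 1) : Near Γ p q := by
  obtain ⟨p', hp', hxp, hpp⟩ := hp.exists_between hΓ.conn hne (s := t + 1 + m) (by omega)
    (hw _ (by simp))
  obtain ⟨q', hq', hyq, hqq⟩ := hq.exists_between hΓ.conn hne (s := t + 1 + m) (by omega)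
    (hw _ (by simp))
  refine hΓ.near_shadow_of_flat hK hne (m := m) (t := t) ?_ hpp hqq hpt hqt
  have := hΓ.flat_shadow_of_walk hK hne (j := t + m) w (fun v hv => by have := hw v hv; omega)
    hxp hyq (by omega) (by omega)
  rw [show t + m + 1 = t + 1 + m by omega] at this
  exact this.mono hl

theorem lev_le_of_isGeodesic {v : ℕ → V} {L i j m : ℕ} (h : IsGeodesic Γ v L) (hij : i ≤ j)
    (hjm : j ≤ m) (hm : m ≤ L) (hi : lev Γ K (v i) ≤ n) (hmn : lev Γ K (v m) ≤ n) :
    lev Γ K (v j) ≤ n := by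
  refine hΓ.lev_le_max hK hne hi hmn ?_
  rw [h i j hij (hjm.trans hm), h j m hjm hm, h i m (hij.trans hjm) hm]
  omega

/-- For a geodesic ending at its minimal level, the shadow of its start stays near its end. By
convexity the part after the first visit to the minimal level is flat, so it has at most 5 edges;
the part before is treated by induction, one level higher. -/
theorem flat_of_descending (L : ℕ) : ∀ {v : ℕ → V} {s : ℕ} {p : V}, IsGeodesic Γ v L →
    lev Γ K (v L) = s + 2 → (∀ i ≤ L, s + 2 ≤ lev Γ K (v i)) → Shadow Γ K (v 0) p →
    lev Γ K p = s + 2 → Flat Γ K (s + 2) 10 p (v L) := by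
  induction L using Nat.strong_induction_on with
  | _ L ih =>
    intro v s p hv hL hmin hp hps
    classical
    have hex : ∃ i, lev Γ K (v i) = s + 2 := ⟨L, hL⟩
    obtain ⟨i, hi, hlt⟩ : ∃ i, lev Γ K (v i) = s + 2 ∧ ∀ j < i, lev Γ K (v j) ≠ s + 2 :=
      ⟨Nat.find hex, Nat.find_spec hex, fun j hj => Nat.find_min hex hj⟩
    have hiL : i ≤ L := by
      by_contra! h
      exact hlt L h hL
    have hflat : ∀ m, i ≤ m → m ≤ L → lev Γ K (v m) = s + 2 := fun m h₁ h₂ =>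
      le_antisymm (hΓ.lev_le_of_isGeodesic hK hne hv h₁ h₂ le_rfl hi.le hL.le) (hmin m h₂)
    have hshort : L - i ≤ 5 := by
      by_contra! h
      have h₁ := hv.flat (K := K) (show i ≤ i + 6 by omega) (by omega)
        fun m h₁ h₂ => hflat m h₁ (by omega)
      rw [Nat.add_sub_cancel_left] at h₁
      have h₂ := hΓ.dist_le_five_of_flat hK hne h₁
      rw [hv i (i + 6) (by omega) (by omega)] at h₂
      omega
    have htail := hv.flat (K := K) hiL le_rfl hflat
    rcases i with _ | i
    · rw [← hp.eq_of_lev hΓ.conn (by omega)]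
      exact htail.mono (by omega)
    · have hadj : Γ.Adj (v i) (v (i + 1)) :=
        SimpleGraph.dist_eq_one_iff_adj.1 (by rw [hv i (i + 1)] <;> omega)
      have hlo : ∀ j ≤ i, s + 1 + 2 ≤ lev Γ K (v j) := fun j hj => by
        have := hmin j (by omega)
        have := hlt j (by omega)
        omega
      have hvi : lev Γ K (v i) = s + 1 + 2 := by
        have := lev_le_of_near hΓ.conn hne (Or.inr hadj)
        have := hlo i le_rfl
        omega
      obtain ⟨p', hp', hvp, hpp⟩ := hp.exists_between hΓ.conn hne (s := s + 1 + 2) (by omega)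
        (hlo 0 (by omega))
      have hfl := ih i (by omega) (hv.mono (by omega)) hvi hlo hvp hp'
      have := hΓ.flat_lower hK hne (n := s + 1) (k := 4) hfl (hpp.adj_of_lev (by omega)) hadj
        hps hi
      -- The bound 10 reproduces itself: halving leaves 5, and the flat tail adds at most 5.
      exact (this.append htail).mono (by omega)

/-- Halving 20 at each level leaves less than 20, so the bound survives any descent. It is the sum
of the bounds 10 for the two halves of a geodesic, split at a lowest vertex. -/
theorem flat_lower_levels {t d : ℕ} (h : Flat Γ K (t + 1 + d) 20 x y) (hp : Shadow Γ K x p)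
    (hq : Shadow Γ K y q) (hpt : lev Γ K p = t + 1) (hqt : lev Γ K q = t + 1) :
    Flat Γ K (t + 1) 20 p q := by
  induction d generalizing x y with
  | zero =>
    rw [← hp.eq_of_lev hΓ.conn (by rw [h.lev_left, hpt, add_zero]),
      ← hq.eq_of_lev hΓ.conn (by rw [h.lev_right, hqt, add_zero])]
    exact h
  | succ d ih =>
    have hx := h.lev_left
    have hy := h.lev_right
    obtain ⟨x', hx', hxx, hxp⟩ := hp.exists_between hΓ.conn hne (s := t + 1 + d) (by omega)
      (by omega)
    obtain ⟨y', hy', hyy, hyq⟩ := hq.exists_between hΓ.conn hne (s := t + 1 + d) (by omega)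
      (by omega)
    refine ih ?_ hxp hyq
    rw [show t + 1 + d = t + d + 1 by omega]
    rw [show t + 1 + (d + 1) = t + d + 2 by omega] at h
    exact (hΓ.flat_lower hK hne (k := 9) h (hxx.adj_of_lev (by omega))
      (hyy.adj_of_lev (by omega)) (by omega) (by omega)).mono (by omega)

/-- Geodesics outside a neighbourhood of a convex set have small shadows. -/
theorem dist_shadow_le {v : ℕ → V} {L t : ℕ} (hv : IsGeodesic Γ v L)
    (ht : ∀ i ≤ L, t + 2 ≤ lev Γ K (v i)) (hp : Shadow Γ K (v 0) p) (hq : Shadow Γ K (v L) q)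
    (hpt : lev Γ K p = t + 2) (hqt : lev Γ K q = t + 2) : Γ.dist p q ≤ 20 := by
  obtain ⟨i, hi, hmin⟩ := Finset.exists_min_image (Finset.range (L + 1)) (fun i => lev Γ K (v i))
    ⟨0, by simp⟩
  have hiL : i ≤ L := by simpa [Nat.lt_succ_iff] using hi
  replace hmin : ∀ j ≤ L, lev Γ K (v i) ≤ lev Γ K (v j) := fun j hj => hmin j (by simp; omega)
  obtain ⟨d, hd⟩ := Nat.exists_eq_add_of_le (ht i hiL)
  obtain ⟨p', hp', hvp, hpp⟩ := hp.exists_between hΓ.conn hne (s := t + d + 2) (by omega)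
    (by have := hmin 0 (by omega); omega)
  obtain ⟨q', hq', hvq, hqq⟩ := hq.exists_between hΓ.conn hne (s := t + d + 2) (by omega)
    (by have := hmin L le_rfl; omega)
  have h₁ := hΓ.flat_of_descending hK hne i (hv.mono hiL) (s := t + d) (by omega)
    (fun j hj => by have := hmin j (by omega); omega) hvp hp'
  have h₂ := hΓ.flat_of_descending hK hne (L - i) (hv.reverse.mono (Nat.sub_le L i))
    (s := t + d) (p := q') (by rw [Nat.sub_sub_self hiL]; omega)
    (fun j hj => by have := hmin (L - j) (by omega); omega) (by simpa using hvq) hq'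
  rw [Nat.sub_sub_self hiL] at h₂
  have h₃ := h₁.append h₂.symm
  rw [show t + d + 2 = t + 1 + 1 + d by omega] at h₃
  exact (hΓ.flat_lower_levels hK hne h₃ hpp hqq hpt hqt).dist_le hΓ.conn

/-- If the shadows of `x` and `y` are far apart, then each geodesic from `x` to `y` passes near
the convex set. -/
theorem exists_lev_lt {t : ℕ} (hp : Shadow Γ K x p) (hq : Shadow Γ K y q)
    (hpt : lev Γ K p = t + 2) (hqt : lev Γ K q = t + 2) (hpq : 20 < Γ.dist p q) :
    ∃ z, Γ.dist x z + Γ.dist z y = Γ.dist x y ∧ lev Γ K z < t + 2 := by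
  obtain ⟨v, h₀, h₁, hv⟩ := exists_isGeodesic hΓ.conn x y
  by_contra! hcon
  have := hΓ.dist_shadow_le hK hne hv (p := p) (q := q) (t := t) (fun i hi => hcon _ ?_)
    (h₀.symm ▸ hp) (h₁.symm ▸ hq) hpt hqt
  · omega
  · have e₁ := hv 0 i (by omega) hi
    have e₂ := hv i _ hi le_rfl
    rw [h₀] at e₁
    rw [h₁] at e₂
    omega

end IsSystolicGraph

/-- A strongly rigid action on the 1-skeleton of an 18-systolic complex. -/
structure IsRigidAction (G : Type*) [Group G] {V : Type*} [MulAction G V] (Γ : SimpleGraph V) :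
    Prop where
  graph : IsSystolicGraph Γ
  adj_smul : ∀ (g : G) {x y : V}, Γ.Adj x y → Γ.Adj (g • x) (g • y)
  rigid : ∀ (g : G) (σ : Set V), σ.Pairwise Γ.Adj → σ.Nontrivial →
    (fun x => g • x) '' σ = σ → g = 1

/-- A set which is invariant under the cyclic group generated by `g`. -/
def IsInvariant {G : Type*} [Group G] {V : Type*} [MulAction G V] (g : G) (K : Set V) : Prop :=
  ∀ (i : ℤ), ∀ x ∈ K, g ^ i • x ∈ K

/-- A coarse centre of `g`: an invariant convex set of uniformly bounded diameter. -/
structure IsCenter {G : Type*} [Group G] {V : Type*} [MulAction G V] (Γ : SimpleGraph V) (g : G)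
    (K : Set V) : Prop where
  convex : IsConvex Γ K
  nonempty : K.Nonempty
  invariant : IsInvariant g K
  dist_le : ∀ x ∈ K, ∀ y ∈ K, Γ.dist x y ≤ 11

/-- The vertex `y` is far from `A`, and it is seen from `A` in the direction of `B`. -/
def SeenBehind {V : Type*} (Γ : SimpleGraph V) (A B : Set V) (N : ℕ) (y : V) : Prop :=
  N ≤ lev Γ A y ∧ ∀ q, Shadow Γ A y q → lev Γ A q = 40 → ∀ x ∈ B, ∀ r, Shadow Γ A x r →
    lev Γ A r = 40 → Γ.dist q r ≤ 2

/-! ### Centres of elements and rigidity -/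

namespace IsRigidAction

variable {G : Type*} [Group G] {V : Type*} [MulAction G V] {Γ : SimpleGraph V}
  (h : IsRigidAction G Γ)
include h

theorem dist_smul_le (g : G) (x y : V) : Γ.dist (g • x) (g • y) ≤ Γ.dist x y := by
  obtain ⟨w, hw⟩ := h.graph.conn.exists_walk_length_eq_dist x y
  let φ : Γ →g Γ := ⟨fun x => g • x, fun hxy => h.adj_smul g hxy⟩
  have := SimpleGraph.dist_le (w.map φ)
  rwa [SimpleGraph.Walk.length_map, hw] at this

theorem dist_smul (g : G) (x y : V) : Γ.dist (g • x) (g • y) = Γ.dist x y := by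
  refine le_antisymm (h.dist_smul_le g x y) ?_
  simpa using h.dist_smul_le g⁻¹ (g • x) (g • y)

theorem dist_zpow_smul (g : G) (i j : ℤ) (x : V) :
    Γ.dist (g ^ i • x) (g ^ j • x) = Γ.dist x (g ^ (j - i) • x) := by
  rw [← h.dist_smul (g ^ i) x, smul_smul, ← zpow_add, add_sub_cancel]

section Invariant

variable {g : G} {K : Set V} (hg : IsInvariant g K) (hne : K.Nonempty)
include hg hne

theorem lev_zpow_smul (i : ℤ) (x : V) : lev Γ K (g ^ i • x) = lev Γ K x := by
  have key : ∀ (i : ℤ) (x : V), lev Γ K (g ^ i • x) ≤ lev Γ K x := by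
    intro i x
    obtain ⟨k, hk, hx⟩ := exists_dist_eq_lev (Γ := Γ) hne x
    rw [← hx, ← h.dist_smul (g ^ i)]
    exact lev_le (hg i k hk) _
  refine le_antisymm (key i x) ?_
  simpa [smul_smul] using key (-i) (g ^ i • x)

theorem shadow_zpow_smul (i : ℤ) {x p : V} (hp : Shadow Γ K x p) :
    Shadow Γ K (g ^ i • x) (g ^ i • p) := by
  unfold Shadow at *
  rwa [h.dist_smul, h.lev_zpow_smul hg hne, h.lev_zpow_smul hg hne]

end Invariant

omit h in
theorem image_eq_of_isInvariant {g : G} {σ : Set V} (hσ : IsInvariant g σ) :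
    (fun x => g • x) '' σ = σ := by
  refine Set.Subset.antisymm ?_ fun x hx => ⟨g⁻¹ • x, ?_, by simp⟩
  · rintro _ ⟨x, hx, rfl⟩
    simpa using hσ 1 x hx
  · simpa using hσ (-1) x hx

theorem eq_one_of_clique {g : G} {σ : Set V} (hσ : IsInvariant g σ)
    (hc : ∀ x ∈ σ, ∀ y ∈ σ, Near Γ x y) (hn : σ.Nontrivial) : g = 1 :=
  h.rigid g σ (fun x hx y hy hxy => (hc x hx y hy).resolve_left hxy) hn
    (image_eq_of_isInvariant hσ)

/-- An element with an invariant convex set and a distant small orbit is trivial. -/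
theorem eq_one_of_orbit {g : G} {K : Set V} (hK : IsConvex Γ K) (hne : K.Nonempty)
    (hg : IsInvariant g K) {p : V} (hp : lev Γ K p = 40)
    (horb : ∀ i : ℤ, Γ.dist p (g ^ i • p) ≤ 31) : g = 1 := by
  have hΓ := h.graph
  let σ : Set V := {v | lev Γ K v = 0 + 1 ∧ ∃ i : ℤ, Shadow Γ K (g ^ i • p) v}
  have hσ : IsInvariant g σ := by
    rintro i v ⟨hv, j, hj⟩
    refine ⟨by rw [h.lev_zpow_smul hg hne, hv], i + j, ?_⟩
    rw [zpow_add, ← smul_smul]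
    exact h.shadow_zpow_smul hg hne i hj
  have hσc : ∀ x ∈ σ, ∀ y ∈ σ, Near Γ x y := by
    rintro x ⟨hx, i, hi⟩ y ⟨hy, j, hj⟩
    obtain ⟨w, hw, hws⟩ := exists_geodesic hΓ.conn (g ^ i • p) (g ^ j • p)
    have hd : Γ.dist (g ^ i • p) (g ^ j • p) ≤ 31 := by
      rw [h.dist_zpow_smul]
      exact horb _
    -- Here 31 + 1 = 2 ^ 5, and the geodesic stays at level at least 40 - 31 = 9, above the required
    -- 1 + 5.
    refine hΓ.near_shadow_of_walk hK hne (m := 5) w (by omega) (fun v hv => ?_) hi hj hx hy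
    have h₁ := hws v hv
    have h₂ := lev_le_add hΓ.conn hne (g ^ i • p) v
    rw [h.lev_zpow_smul hg hne, hp] at h₂
    omega
  -- If the invariant clique σ is a single vertex m, that vertex is fixed, and adding its neighbours
  -- in K gives an invariant clique with at least two vertices.
  rcases σ.subsingleton_or_nontrivial with hs | hn
  · obtain ⟨m, hm, hpm⟩ := exists_shadow (x := p) hΓ.conn hne (s := 0 + 1) (by omega)
    have hmσ : m ∈ σ := ⟨hm, 0, by simpa using hpm⟩
    have hfix : ∀ i : ℤ, g ^ i • m = m := fun i => hs (hσ i m hmσ) hmσ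
    obtain ⟨k, hmk, hk⟩ := exists_lower_neighbor hΓ.conn hne hm
    refine h.eq_one_of_clique (g := g) (σ := {v | v = m ∨ Γ.Adj m v ∧ lev Γ K v = 0}) ?_ ?_
      ⟨m, Or.inl rfl, k, Or.inr ⟨hmk, hk⟩, hmk.ne⟩
    · rintro i v (rfl | ⟨hv, hl⟩)
      · exact Or.inl (hfix i)
      · refine Or.inr ⟨?_, by rw [h.lev_zpow_smul hg hne, hl]⟩
        rw [← hfix i]
        exact h.adj_smul _ hv
    · rintro x (rfl | ⟨hx, hx0⟩) y (rfl | ⟨hy, hy0⟩)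
      · exact Near.refl _
      · exact Or.inr hy
      · exact Or.inr hx.symm
      · exact hΓ.lev_clique hK hne hm hx hy hx0 hy0
  · exact h.eq_one_of_clique hσ hσc hn

omit h in
theorem _root_.Systolic.IsSystolicGraph.isConvex_singleton (hΓ : IsSystolicGraph Γ) (x : V) :
    IsConvex Γ {x} := by
  rintro a rfl b rfl m hm
  rw [SimpleGraph.dist_self] at hm
  exact (hΓ.conn.dist_eq_zero_iff.1 (by omega)).symm

omit h in
theorem _root_.Systolic.lev_singleton (x y : V) : lev Γ {y} x = Γ.dist x y := by
  simp [lev]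

/-- The centre consists of the vertices whose greatest distance to the orbit is the least possible
r. It is an intersection of balls, hence convex. Were there a geodesic of length at least 12 in it,
each of its first two segments of length 6 would dip below distance r from any given orbit point,
being too long to be flat; by convexity of balls `v 6` would then be within r - 1 of the whole
orbit. -/
theorem exists_isCenter {g : G} {x₀ : V} {n : ℕ} (hn : ∀ i : ℤ, Γ.dist x₀ (g ^ i • x₀) ≤ n) :
    ∃ K, IsCenter Γ g K := by
  classical
  have hΓ := h.graph
  let Z : ℕ → Set V := fun r => {z | ∀ i : ℤ, Γ.dist z (g ^ i • x₀) ≤ r}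
  have hex : ∃ r, (Z r).Nonempty := ⟨n, x₀, hn⟩
  obtain ⟨r, hr, hmin⟩ : ∃ r, (Z r).Nonempty ∧ ∀ s < r, ¬ (Z s).Nonempty :=
    ⟨Nat.find hex, Nat.find_spec hex, fun j hj => Nat.find_min hex hj⟩
  refine ⟨Z r, ?_, hr, ?_, ?_⟩
  · intro a ha b hb m hm i
    have := hΓ.lev_le_max (hΓ.isConvex_singleton (g ^ i • x₀)) (Set.singleton_nonempty _) (n := r)
      (by rw [lev_singleton]; exact ha i) (by rw [lev_singleton]; exact hb i) hm
    rwa [lev_singleton] at this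
  · intro i z hz j
    have := hz (j - i)
    rwa [← h.dist_smul (g ^ i), smul_smul, ← zpow_add, add_sub_cancel] at this
  · intro x hx y hy
    by_contra! hlt
    obtain ⟨v, hv₀, hv₁, hv⟩ := exists_isGeodesic hΓ.conn x y
    -- The bound on flat segments needs level at least two; for smaller r the diameter is at most 2
    -- anyway.
    rcases (by omega : r ≤ 1 ∨ 2 ≤ r) with hr1 | hr2
    · have h₁ := hx 0
      have h₂ := hy 0
      rw [SimpleGraph.dist_comm] at h₂
      have := hΓ.conn.dist_triangle (u := x) (v := g ^ (0 : ℤ) • x₀) (w := y)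
      omega
    obtain ⟨s, rfl⟩ := Nat.exists_eq_add_of_le' hr2
    refine hmin (s + 1) (by omega) ⟨v 6, fun i => ?_⟩
    have hc := hΓ.isConvex_singleton (g ^ i • x₀)
    have hs : ({g ^ i • x₀} : Set V).Nonempty := Set.singleton_nonempty _
    rw [← lev_singleton]
    by_contra! h6
    have hle : ∀ j ≤ Γ.dist x y, lev Γ {g ^ i • x₀} (v j) ≤ s + 2 := fun j hj => by
      refine hΓ.lev_le_of_isGeodesic hc hs hv (Nat.zero_le j) hj le_rfl ?_ ?_
      · rw [hv₀, lev_singleton]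
        exact hx i
      · rw [hv₁, lev_singleton]
        exact hy i
    have hno : ∀ j, j + 6 ≤ Γ.dist x y →
        ¬ ∀ m, j ≤ m → m ≤ j + 6 → lev Γ {g ^ i • x₀} (v m) = s + 2 := fun j hj hflat => by
      have h₁ := hv.flat (K := {g ^ i • x₀}) (show j ≤ j + 6 by omega) hj hflat
      rw [Nat.add_sub_cancel_left] at h₁
      have h₂ := hΓ.dist_le_five_of_flat hc hs h₁
      rw [hv j (j + 6) (by omega) hj] at h₂
      omega
    have h0 := hno 0 (by omega)
    have h1 := hno 6 (by omega)
    push Not at h0 h1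
    obtain ⟨m, -, hm6, hm⟩ := h0
    obtain ⟨m', hm6', hm12, hm'⟩ := h1
    have := hle m (by omega)
    have := hle m' (by omega)
    have := hΓ.lev_le_of_isGeodesic hc hs hv (i := m) (j := 6) (m := m') (n := s + 1) (by omega)
      hm6' (by omega) (by omega) (by omega)
    omega

/-! ### Ping-pong between two distant centres -/

section Pair

variable {A B : Set V} (hA : IsConvex Γ A) (hAn : A.Nonempty) (hB : IsConvex Γ B)
  (hBn : B.Nonempty) (hAB : ∀ x ∈ A, ∀ y ∈ B, 200 ≤ Γ.dist x y)
  (hBd : ∀ x ∈ B, ∀ y ∈ B, Γ.dist x y ≤ 11)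
include hA hAn hBn hAB hBd

omit h hA hBn hBd in
theorem le_lev_of_mem {y : V} (hy : y ∈ B) : 200 ≤ lev Γ A y := by
  obtain ⟨k, hk, hd⟩ := exists_dist_eq_lev (Γ := Γ) hAn y
  rw [← hd, SimpleGraph.dist_comm]
  exact hAB k hk y hy

omit hBn hBd in
-- A geodesic of length at most 60 < 2 ^ 6 starting in B stays at level at least 140 over A, far
-- above 40 + 6.
theorem near_shadow_of_close {z x p q : V} (hz : Γ.dist z x ≤ 60) (hx : x ∈ B)
    (hp : Shadow Γ A z p) (hq : Shadow Γ A x q) (hpl : lev Γ A p = 40) (hql : lev Γ A q = 40) :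
    Near Γ p q := by
  obtain ⟨w, hw, hws⟩ := exists_geodesic h.graph.conn z x
  refine h.graph.near_shadow_of_walk hA hAn (m := 6) (t := 39) w (by omega) (fun v hv => ?_) hp hq
    hpl hql
  have h₁ := hws v hv
  have h₂ := lev_le_add h.graph.conn hAn x v
  rw [SimpleGraph.dist_comm] at h₂
  have h₃ := le_lev_of_mem hAn hAB hx
  omega

omit hBn in
theorem seenBehind_of_mem {y : V} (hy : y ∈ B) : SeenBehind Γ A B 200 y :=
  ⟨le_lev_of_mem hAn hAB hy, fun q hq hql x hx r hr hrl =>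
    ((h.near_shadow_of_close hA hAn hAB ((hBd y hy x hx).trans (by norm_num)) hx hq hr hql
      hrl).dist_le).trans (by norm_num)⟩

include hB in
-- The ping-pong step. Seen from B, the vertex y lies in the direction of A, and `b ^ i` turns this
-- direction away by a large amount. So a geodesic from the image of y to A must pass close to B,
-- which makes the image far from A and seen from A in the direction of B.
theorem seenBehind_smul {b : G} (hb : IsInvariant b B) {x₀ p₀ : V} (hx₀ : x₀ ∈ A)
    (hp₀ : Shadow Γ B x₀ p₀) (hp₀l : lev Γ B p₀ = 40) {i : ℤ}
    (hi : 31 < Γ.dist p₀ (b ^ i • p₀)) {N : ℕ} (hN : 40 ≤ N) {y : V}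
    (hy : SeenBehind Γ B A N y) : SeenBehind Γ A B (N + 100) (b ^ i • y) := by
  have hΓ := h.graph
  have hc := hΓ.conn
  have hBA : ∀ x ∈ B, ∀ y ∈ A, 200 ≤ Γ.dist x y := fun x hx y hy => by
    rw [SimpleGraph.dist_comm]
    exact hAB y hy x hx
  obtain ⟨hyN, hyA⟩ := hy
  obtain ⟨x, hxA, hx⟩ := exists_dist_eq_lev (Γ := Γ) hAn (b ^ i • y)
  obtain ⟨q, hql, hq⟩ := exists_shadow (x := y) hc hBn (s := 40) (by omega)
  obtain ⟨p, hpl, hp⟩ := exists_shadow (x := x) hc hBn (s := 40)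
    (by have := le_lev_of_mem hBn hBA hxA; omega)
  have hqp₀ := hyA q hq hql x₀ hx₀ p₀ hp₀ hp₀l
  have hqp := hyA q hq hql x hxA p hp hpl
  -- Both p and p₀ are within 2 of q, so of the displacement of at least 32 there remains at least
  -- 32 - 4 - 2 = 26.
  have hfar : 20 < Γ.dist (b ^ i • q) p := by
    have t₁ := hc.dist_triangle (u := p₀) (v := p) (w := b ^ i • p₀)
    have t₂ := hc.dist_triangle (u := p₀) (v := q) (w := p)
    have t₃ := hc.dist_triangle (u := p) (v := b ^ i • q) (w := b ^ i • p₀)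
    rw [h.dist_smul] at t₃
    rw [SimpleGraph.dist_comm (u := p₀) (v := q)] at t₂
    rw [SimpleGraph.dist_comm (u := p) (v := b ^ i • q)] at t₃
    omega
  obtain ⟨z, hz, hzB⟩ := hΓ.exists_lev_lt hB hBn (t := 38) (h.shadow_zpow_smul hb hBn i hq) hp
    (by rw [h.lev_zpow_smul hb hBn, hql]) hpl hfar
  obtain ⟨k, hkB, hk⟩ := exists_dist_eq_lev (Γ := Γ) hBn z
  have hkA := le_lev_of_mem hAn hAB hkB
  have l₁ := lev_le_add hc hAn k z
  rw [SimpleGraph.dist_comm] at l₁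
  have l₂ := lev_le_add hc hBn (b ^ i • y) z
  rw [h.lev_zpow_smul hb hBn] at l₂
  have l₃ := lev_le_add hc hAn (b ^ i • y) z
  have l₄ := lev_le (Γ := Γ) hxA z
  -- The vertex z is within 39 of B, hence at least N - 39 from the image of y and at least 161 from
  -- A; the sum exceeds N + 100.
  refine ⟨by omega, fun q' hq' hql' x' hx' r hr hrl => ?_⟩
  have hyz : Shadow Γ A (b ^ i • y) z := by unfold Shadow; omega
  obtain ⟨s, hsl, hs⟩ := exists_shadow (x := z) hc hAn (s := 40) (by omega)
  have n₁ := (hΓ.near_shadow hA hAn (j := 39) (Near.refl _) hq' (hyz.trans hc hAn hs) hql'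
    hsl).dist_le
  have hzx : Γ.dist z x' ≤ 60 := by
    have := hc.dist_triangle (u := z) (v := k) (w := x')
    have := hBd k hkB x' hx'
    omega
  have n₂ := (h.near_shadow_of_close hA hAn hAB hzx hx' hs hr hsl hrl).dist_le
  have := hc.dist_triangle (u := q') (v := s) (w := r)
  omega

end Pair

/-- Coarse centres of nontrivial elements are close to each other. -/
theorem exists_dist_lt_of_isCenter
    (hloc : ∀ g : G, ∃ (x : V) (n : ℕ), ∀ i : ℤ, Γ.dist x (g ^ i • x) ≤ n) {a b : G} (ha : a ≠ 1)
    (hb : b ≠ 1) {A B : Set V} (hA : IsCenter Γ a A) (hB : IsCenter Γ b B) :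
    ∃ x ∈ A, ∃ y ∈ B, Γ.dist x y < 200 := by
  have hc := h.graph.conn
  by_contra! hAB
  have hBA : ∀ x ∈ B, ∀ y ∈ A, 200 ≤ Γ.dist x y := fun x hx y hy => by
    rw [SimpleGraph.dist_comm]
    exact hAB y hy x hx
  have key : ∀ {g : G} {C D : Set V}, g ≠ 1 → IsCenter Γ g C → D.Nonempty →
      (∀ x ∈ C, ∀ y ∈ D, 200 ≤ Γ.dist x y) → ∃ x ∈ D, ∃ p, Shadow Γ C x p ∧ lev Γ C p = 40 ∧
        ∃ i : ℤ, 31 < Γ.dist p (g ^ i • p) := by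
    intro g C D hg hC ⟨x, hx⟩ hCD
    have := le_lev_of_mem hC.nonempty hCD hx
    obtain ⟨p, hpl, hp⟩ := exists_shadow (x := x) hc hC.nonempty (s := 40) (by omega)
    refine ⟨x, hx, p, hp, hpl, ?_⟩
    by_contra! hcon
    exact hg (h.eq_one_of_orbit hC.convex hC.nonempty hC.invariant hpl hcon)
  obtain ⟨x₀, hx₀, p, hp, hpl, i, hi⟩ := key hb hB hA.nonempty hBA
  obtain ⟨y₀, hy₀, q, hq, hql, j, hj⟩ := key ha hA hB.nonempty hAB
  have step : ∀ {N : ℕ} {y : V}, 40 ≤ N → SeenBehind Γ A B N y →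
      SeenBehind Γ A B (N + 200) ((b ^ i * a ^ j) • y) := by
    intro N y hN hy
    have h₁ := h.seenBehind_smul hB.convex hB.nonempty hA.convex hA.nonempty hBA hA.dist_le
      hA.invariant hy₀ hq hql hj hN hy
    have h₂ := h.seenBehind_smul hA.convex hA.nonempty hB.convex hB.nonempty hAB hB.dist_le
      hB.invariant hx₀ hp hpl hi (by omega) h₁
    rwa [smul_smul] at h₂
  have hseq : ∀ n : ℕ, SeenBehind Γ A B (200 + 200 * n) ((b ^ i * a ^ j) ^ n • y₀) := by
    intro n
    induction n with
    | zero =>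
      rw [pow_zero, one_smul, Nat.mul_zero, Nat.add_zero]
      exact h.seenBehind_of_mem hA.convex hA.nonempty hAB hB.dist_le hy₀
    | succ n ih =>
      have := step (by omega) ih
      rw [Nat.mul_succ, ← Nat.add_assoc]
      rwa [smul_smul, ← pow_succ'] at this
  obtain ⟨x, N, hN⟩ := hloc (b ^ i * a ^ j)
  -- After n rounds the vertex is at least 200 + 200 n from A, while the bounded orbit of x keeps it
  -- within n.
  set n := Γ.dist y₀ x + N + lev Γ A x
  have h₁ := (hseq n).1
  have h₂ := lev_le_add hc hA.nonempty ((b ^ i * a ^ j) ^ n • y₀) x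
  have h₃ := hc.dist_triangle (u := (b ^ i * a ^ j) ^ n • y₀) (v := (b ^ i * a ^ j) ^ n • x)
    (w := x)
  rw [h.dist_smul] at h₃
  have h₄ := hN n
  rw [zpow_natCast, SimpleGraph.dist_comm] at h₄
  omega

theorem isCenter_conj {a : G} {A : Set V} (hA : IsCenter Γ a A) (g : G) :
    IsCenter Γ (g * a * g⁻¹) {x | g⁻¹ • x ∈ A} where
  convex := by
    intro x hx y hy m hm
    refine hA.convex _ hx _ hy _ ?_
    simpa only [h.dist_smul] using hm
  nonempty := by
    obtain ⟨x, hx⟩ := hA.nonempty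
    exact ⟨g • x, by simpa using hx⟩
  invariant := by
    intro i x hx
    rw [conj_zpow]
    have := hA.invariant i _ hx
    simpa [smul_smul, mul_assoc] using this
  dist_le := by
    intro x hx y hy
    have := hA.dist_le _ hx _ hy
    rwa [h.dist_smul] at this

/-- The translate by g of a centre of a is a centre of the conjugate of a by g, so it is less than
200 away; the two diameters add 11 each. -/
theorem exists_bounded_orbit
    (hloc : ∀ g : G, ∃ (x : V) (n : ℕ), ∀ i : ℤ, Γ.dist x (g ^ i • x) ≤ n) :
    ∃ (x : V) (n : ℕ), ∀ g : G, Γ.dist x (g • x) ≤ n := by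
  by_cases htriv : ∀ g : G, g = 1
  · obtain ⟨x⟩ := h.graph.conn.nonempty
    exact ⟨x, 0, fun g => by simp [htriv g]⟩
  push Not at htriv
  obtain ⟨a, ha⟩ := htriv
  obtain ⟨x₀, n, hn⟩ := hloc a
  obtain ⟨A, hA⟩ := h.exists_isCenter hn
  obtain ⟨x, hx⟩ := hA.nonempty
  refine ⟨x, 222, fun g => ?_⟩
  obtain ⟨y, hy, z, hz, hyz⟩ := h.exists_dist_lt_of_isCenter hloc ha
    (b := g * a * g⁻¹) (by simpa using ha) hA (h.isCenter_conj hA g)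
  have h₁ := hA.dist_le x hx y hy
  have h₂ := hA.dist_le _ hz x hx
  rw [← h.dist_smul g, smul_inv_smul] at h₂
  have t₁ := h.graph.conn.dist_triangle (u := x) (v := y) (w := g • x)
  have t₂ := h.graph.conn.dist_triangle (u := y) (v := z) (w := g • x)
  omega

end IsRigidAction

/-! ### Passage from complexes to their 1-skeleta, and the conclusion -/

theorem isSystolicGraph_skeleton {V : Type*} {X : AbstractSimplicialComplex V}
    (hX : IsSystolic 18 X) : IsSystolicGraph (skeleton X) where
  conn := hX.1.1
  cycles := hX.2.2
  tri := (triangleCondition_and_cliqueCondition hX.1 hX.2.2).1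
  clique := (triangleCondition_and_cliqueCondition hX.1 hX.2.2).2

theorem isRigidAction_skeleton {G : Type*} [Group G] {V : Type*} [MulAction G V]
    {X : AbstractSimplicialComplex V} (hX : IsSystolic 18 X) (hAut : ActsByAutomorphisms G X)
    (hRigid : ActsStronglyRigidly G X) : IsRigidAction G (skeleton X) where
  graph := isSystolicGraph_skeleton hX
  adj_smul := by
    rintro g x y ⟨hne, s, hs, hx, hy⟩
    exact ⟨fun he => hne (MulAction.injective g he), _, hAut g s hs,
      Finset.mem_map_of_mem _ hx, Finset.mem_map_of_mem _ hy⟩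
  -- Flagness turns pairwise adjacent vertices, even infinitely many, into a possibly infinite
  -- simplex.
  rigid := fun g σ hσ hn him => hRigid g σ
    ⟨hn.nonempty, fun s hs hsσ => hX.2.1 s hs (hσ.mono hsσ)⟩ hn him

theorem edist_le_iff_dist_le {V : Type*} {Γ : SimpleGraph V} (hc : Γ.Connected) {x y : V} {n : ℕ} :
    Γ.edist x y ≤ (n : ℕ∞) ↔ Γ.dist x y ≤ n := by
  rw [← (hc x y).coe_dist_eq_edist, Nat.cast_le]

end Systolic

theorem mainTheorem6 {G : Type*} [Group G] [Group.FG G] {V : Type*} [MulAction G V]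
    (X : AbstractSimplicialComplex V)
    (hX : Systolic.IsSystolic 18 X)
    (hAut : Systolic.ActsByAutomorphisms G X)
    (hRigid : Systolic.ActsStronglyRigidly G X)
    (hLoc : Systolic.ActsLocallyElliptically G X) :
    Systolic.ActsElliptically G X := by
  have h := Systolic.isRigidAction_skeleton hX hAut hRigid
  obtain ⟨x, n, hn⟩ := h.exists_bounded_orbit fun g => by
    obtain ⟨x, n, hn⟩ := hLoc g
    refine ⟨x, n, fun i => (Systolic.edist_le_iff_dist_le hX.1.1).1 ?_⟩
    exact hn x (MulAction.mem_orbit_self x) _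
      ⟨⟨g ^ i, Subgroup.zpow_mem_zpowers g i⟩, rfl⟩
  refine ⟨x, n, ?_⟩
  rintro _ ⟨g, rfl⟩ _ ⟨g', rfl⟩
  refine (Systolic.edist_le_iff_dist_le hX.1.1).2 ?_
  have := hn (g⁻¹ * g')
  rwa [← h.dist_smul g, smul_smul, mul_inv_cancel_left] at this
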